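/- All functions are real-valued and $2\pi$-periodic on $\mathbb{R}$. Let $\Lambda=\{\lambda_n\}_{n\ge 1}$ be a nondecreasing sequence of positive numbers tending to infinity with $\sum 1/\lambda_n=\infty$. A function $f$ belongs to $\Lambda BV$ if $$V_\Lambda(f)=\sup\sum_{i}\frac{|f(\beta_i)-f(\alpha_i)|}{\lambda_i}<\infty,$$ the supremum being over all finite sequences $[\alpha_1,\beta_1],[\alpha_2,\beta_2],\dots$ (in any order) of nonoverlapping subintervals of $[0,2\pi]$. The class $HBV$ (harmonic bounded variation) is $\Lambda BV$ for $\lambda_n=n$. Functions in these classes have one-sided limits $g(x\pm 0)$ at every point. For such $g$ let $a_k(g)=\frac1\pi\int_{-\pi}^{\pi}g(t)\cos kt\,dt$ and $b_k(g)=\frac1\pi\int_{-\pi}^{\pi}g(t)\sin kt\,dt$. For an integer $s\ge 0$ and $n\ge1$ let $$R_n^{(-s)}(g,x)=\sum_{k=n}^{\infty}T_k^{(-s)}(x),\qquad T_k(x)=a_k(g)\cos kx+b_k(g)\sin kx,$$ be the $n$th order tail of the $s$ times integrated Fourier series of $g$. Here $T^{(0)}=T$, and $T^{(-s-1)}$ is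 the antiderivative of $T^{(-s)}$ with $\int_{-\pi}^{\pi}T^{(-s-1)}(t)\,dt=0$. (a) Let $g\in HBV$. For every point $x_0$ and every $r=0,1,2,\dots$, the series defining $R_n^{(-2r-1)}(g,x_0)$ converges and $$\lim_{n\to\infty}n^{2r+1}R_n^{(-2r-1)}(g,x_0)=\frac{(-1)^{r+1}}{(2r+1)\pi}\bigl[g(x_0+0)-g(x_0-0)\bigr].$$ No finiteness assumption is made on the number of discontinuities of $g$. (b) If $\Lambda$ is such that $\Lambda BV\supsetneqq HBV$, then (a) fails for $\Lambda BV\setminus HBV$: there are a function $g\in\Lambda BV\setminus HBV$ and a point $x_0$ such that, for every $r=0,1,2,\dots$, the series defining $R_n^{(-2r-1)}(g,x_0)$ converges, but the limit relation in (a) does not hold. -/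

import Mathlib

open Filter Topology
open scoped ENNReal

noncomputable section

/-- A Waterman sequence `Λ`: a nondecreasing sequence of positive numbers tending to infinity whose
reciprocals have a divergent sum. The entry `lam i` is the term of index `i + 1`. -/
structure IsWatermanSeq (lam : ℕ → ℝ) : Prop where
  pos : ∀ i, 0 < lam i
  mono : Monotone lam
  tendsto_atTop : Tendsto lam atTop atTop
  not_summable : ¬ Summable fun i => 1 / lam i

/-- A finite sequence of nondegenerate, nonoverlapping subintervals `[a i, b i]` of `[0, 2π]`,
listed in an arbitrary order. -/
structure IsNonoverlapping {N : ℕ} (a b : Fin N → ℝ) : Prop where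
  lt : ∀ i, a i < b i
  left_mem : ∀ i, 0 ≤ a i
  right_mem : ∀ i, b i ≤ 2 * Real.pi
  disjoint : ∀ i j, i ≠ j → Disjoint (Set.Ioo (a i) (b i)) (Set.Ioo (a j) (b j))

/-- The `Λ`-variation of `f` on `[0, 2π]`, as an extended nonnegative number. -/
def lambdaVariation (lam : ℕ → ℝ) (f : ℝ → ℝ) : ℝ≥0∞ :=
  ⨆ (N : ℕ) (a : Fin N → ℝ) (b : Fin N → ℝ) (_ : IsNonoverlapping a b),
    ENNReal.ofReal (∑ i : Fin N, |f (b i) - f (a i)| / lam i)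

/-- The class `ΛBV` of `2π`-periodic functions of bounded `Λ`-variation on `[0, 2π]`. -/
def LambdaBV (lam : ℕ → ℝ) : Set (ℝ → ℝ) :=
  {f | Function.Periodic f (2 * Real.pi) ∧ lambdaVariation lam f < ⊤}

/-- The class `HBV`: the case `Λ = {1, 2, 3, …}`. -/
def HBV : Set (ℝ → ℝ) := LambdaBV fun i => (i : ℝ) + 1

/-- The cosine coefficients of `g`. -/
def fourierCos (g : ℝ → ℝ) (k : ℕ) : ℝ :=
  1 / Real.pi * ∫ t in (-Real.pi)..Real.pi, g t * Real.cos (k * t)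

/-- The sine coefficients of `g`. -/
def fourierSin (g : ℝ → ℝ) (k : ℕ) : ℝ :=
  1 / Real.pi * ∫ t in (-Real.pi)..Real.pi, g t * Real.sin (k * t)

/-- The term of index `k` of the Fourier series of `g`. -/
def fourierTerm (g : ℝ → ℝ) (k : ℕ) (x : ℝ) : ℝ :=
  fourierCos g k * Real.cos (k * x) + fourierSin g k * Real.sin (k * x)

/-- The antiderivative of `f` whose constant of integration is determined by the condition
that its integral over `[-π, π]` vanishes. -/
def zeroMeanPrimitive (f : ℝ → ℝ) (x : ℝ) : ℝ :=
  (∫ t in (0 : ℝ)..x, f t)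
    - 1 / (2 * Real.pi) * ∫ u in (-Real.pi)..Real.pi, ∫ t in (0 : ℝ)..u, f t

/-- The `s`-fold integral `f^{(-s)}`. -/
def iteratedPrimitive (s : ℕ) (f : ℝ → ℝ) : ℝ → ℝ := zeroMeanPrimitive^[s] f

/-- The partial sums over `n ≤ k < N` of the `s` times integrated Fourier series of `g` at `x`. -/
def integratedPartialSum (s : ℕ) (g : ℝ → ℝ) (n N : ℕ) (x : ℝ) : ℝ :=
  ∑ k ∈ Finset.Ico n N, iteratedPrimitive s (fourierTerm g k) x

/-- The tail `R_n^{(-s)}(g, x)`: the sum over `k ≥ n`, as a limit of partial sums, of the `s` times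
integrated Fourier series of `g` at `x`. For `s = 0` it is the tail of the Fourier series. -/
def integratedTail (s : ℕ) (g : ℝ → ℝ) (n : ℕ) (x : ℝ) : ℝ :=
  limUnder atTop fun N => integratedPartialSum s g n N x

/-- The series defining `R_n^{(-s)}(g, x)` converges for every `n`. -/
def TailConverges (s : ℕ) (g : ℝ → ℝ) (x : ℝ) : Prop :=
  ∀ n, ∃ l, Tendsto (fun N => integratedPartialSum s g n N x) atTop (𝓝 l)

/-- The jump formula of order `r` for `g` at `x`, with one-sided limits `gp` and `gm`:
`n^{2r+1} R_n^{(-2r-1)}(g, x) → (-1)^{r+1} / ((2r+1)π) * (gp - gm)`. -/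
def JumpFormula (r : ℕ) (g : ℝ → ℝ) (x gp gm : ℝ) : Prop :=
  Tendsto (fun n : ℕ => (n : ℝ) ^ (2 * r + 1) * integratedTail (2 * r + 1) g n x) atTop
    (𝓝 ((-1) ^ (r + 1) / ((2 * r + 1) * Real.pi) * (gp - gm)))

end

/-! An odd number of integrations turns the `k`th Fourier term at `x` into `(-1)^(r+1) β_k /
k^(2r+1)`, where `β_k` (`jumpCoeff`) is the `k`th sine coefficient of `u ↦ g (x + u)`. Put `σ_n =
∑_{k ≤ n} k β_k` (`jumpSum`). Summation by parts removes `r` from the problem: if `σ_n / n` tends to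
the jump divided by `π`, then the jump formula holds for every `r` (`tendsto_pow_mul_tail`);
conversely, the formula for a single `r` forces `σ_n = O(n)` (`abs_weighted_sum_le_of_tail`).

For (a), `σ_n / n` is `1/π` times the integral of `g (x + u)` against an odd kernel whose integral
over `[0, π]` tends to `1`. After subtracting the one-sided limit, only a neighbourhood of `0`
matters. There the dangerous part of the kernel is `-½ cot(u/2) cos(nu)`. Cutting at multiples of
`π/n` gives alternating signs and amplitudes at most `(n/π)/(i+1)`, so what survives is a sum of
differences of `g` with weights `1/(i+1)`, that is, harmonic variation
(`abs_integral_halfCot_cos_le`). This variation is small near the point by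
`VariationLE.exists_small`.

For (b), the sawtooth `(u - π) cos(Nu)` has Λ-variation `O(∑_{i ≤ N} 1/λ_i)`, while resonance near
`k = N` makes its `σ_N / N` at `0` at least `H_N - 5/2`, with `H_N` the harmonic sum. If `ΛBV` is
not inside `HBV`, then `H_N` is not `O(∑_{i ≤ N} 1/λ_i)` (`lambdaBV_subset_HBV`). The uniform
boundedness principle on `ℓ¹` then combines normalised sawtooths into a `g` in `ΛBV` with `σ_n / n`
unbounded at `0`. The formula fails there for all `r`, and by (a) this also shows that `g` is not in
`HBV`. -/

/-! ### One-sided limits and local Λ-variation -/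

/-- The first `N` intervals `[a i, b i]` are nondegenerate, nonoverlapping and lie in `(0, δ)`. -/
structure IsFamilyIn (δ : ℝ) (N : ℕ) (a b : ℕ → ℝ) : Prop where
  lt : ∀ i < N, a i < b i
  pos : ∀ i < N, 0 < a i
  right_lt : ∀ i < N, b i < δ
  disjoint : ∀ i < N, ∀ j < N, i ≠ j → Disjoint (Set.Ioo (a i) (b i)) (Set.Ioo (a j) (b j))

/-- The `Λ`-variation of `f` over the open interval `(0, δ)` is at most `V`. -/
def VariationLE (lam : ℕ → ℝ) (δ V : ℝ) (f : ℝ → ℝ) : Prop :=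
  ∀ N a b, IsFamilyIn δ N a b → ∑ i ∈ Finset.range N, |f (b i) - f (a i)| / lam i ≤ V

lemma IsFamilyIn.mono {δ δ' : ℝ} {N : ℕ} {a b : ℕ → ℝ} (h : IsFamilyIn δ N a b) (hδ : δ ≤ δ') :
    IsFamilyIn δ' N a b :=
  ⟨h.lt, h.pos, fun i hi => (h.right_lt i hi).trans_le hδ, h.disjoint⟩

lemma isWatermanSeq_nat_add_one : IsWatermanSeq fun i => (i : ℝ) + 1 where
  pos i := by positivity
  mono i j h := by simpa using h
  tendsto_atTop := tendsto_atTop_add_const_right _ _ tendsto_natCast_atTop_atTop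
  not_summable h := by
    have := (summable_nat_add_iff (f := fun i : ℕ => 1 / (i : ℝ)) 1).1 (by simpa using h)
    exact Real.not_summable_one_div_natCast this

lemma IsWatermanSeq.tendsto_sum {lam : ℕ → ℝ} (h : IsWatermanSeq lam) :
    Tendsto (fun n => ∑ i ∈ Finset.range n, 1 / lam i) atTop atTop :=
  (not_summable_iff_tendsto_nat_atTop_of_nonneg fun i => (one_div_pos.2 (h.pos i)).le).1
    h.not_summable

/-- Induction from right to left: one large oscillation is placed on `[x, y]`, and the others are
then found inside `(0, x)`. -/
lemma exists_large_oscillations {f : ℝ → ℝ} {η : ℝ}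
    (h : ∀ δ > 0, ∃ x y, 0 < x ∧ x < y ∧ y < δ ∧ η ≤ |f y - f x|) (N : ℕ) :
    ∀ δ > 0, ∃ a b, IsFamilyIn δ N a b ∧ ∀ i < N, η ≤ |f (b i) - f (a i)| := by
  induction N with
  | zero => exact fun δ _ => ⟨0, 0, ⟨by simp, by simp, by simp, by simp⟩, by simp⟩
  | succ N ih =>
    intro δ hδ
    obtain ⟨x, y, hx, hxy, hy, hη⟩ := h δ hδ
    obtain ⟨a, b, hab, hab'⟩ := ih x hx
    have key : ∀ i < N, Disjoint (Set.Ioo (a i) (b i)) (Set.Ioo x y) := fun i hi =>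
      Set.disjoint_left.2 fun z hz hz' => by
        have := hab.right_lt i hi
        have := hz.2; have := hz'.1
        linarith
    refine ⟨fun i => if i < N then a i else x, fun i => if i < N then b i else y,
      ⟨?_, ?_, ?_, ?_⟩, ?_⟩
    · intro i _
      by_cases hi : i < N
      · simpa [hi] using hab.lt i hi
      · simpa [hi] using hxy
    · intro i _
      by_cases hi : i < N
      · simpa [hi] using hab.pos i hi
      · simpa [hi] using hx
    · intro i _
      by_cases hi : i < N
      · simpa [hi] using (hab.right_lt i hi).trans (hxy.trans hy)
      · simpa [hi] using hy
    · intro i hi' j hj' hij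
      by_cases hi : i < N <;> by_cases hj : j < N
      · simpa [hi, hj] using hab.disjoint i hi j hj hij
      · simpa [hi, hj] using key i hi
      · simpa [hi, hj] using (key j hj).symm
      · omega
    · intro i _
      by_cases hi : i < N
      · simpa [hi] using hab' i hi
      · simpa [hi] using hη

/-- If the Cauchy criterion failed at `0+`, there would be arbitrarily many disjoint oscillations of
size `η`, and `η ∑ 1/λ_i` would exceed any bound. -/
lemma VariationLE.exists_tendsto {lam : ℕ → ℝ} (hl : IsWatermanSeq lam) {δ V : ℝ} (hδ : 0 < δ)
    {f : ℝ → ℝ} (hf : VariationLE lam δ V f) : ∃ L, Tendsto f (𝓝[>] 0) (𝓝 L) := by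
  apply cauchy_map_iff_exists_tendsto.1
  rw [Metric.cauchy_iff]
  refine ⟨inferInstance, ?_⟩
  by_contra! hcon
  obtain ⟨η, hη, hc⟩ := hcon
  have hosc : ∀ δ > 0, ∃ x y, 0 < x ∧ x < y ∧ y < δ ∧ η ≤ |f y - f x| := by
    intro δ' hδ'
    obtain ⟨p, ⟨x, hx, rfl⟩, q, ⟨y, hy, rfl⟩, hpq⟩ := hc (f '' Set.Ioo 0 δ')
      (image_mem_map (Ioo_mem_nhdsGT hδ'))
    rw [Real.dist_eq] at hpq
    rcases lt_trichotomy x y with h | h | h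
    · exact ⟨x, y, hx.1, h, hy.2, by rwa [abs_sub_comm]⟩
    · subst h; simp at hpq; linarith
    · exact ⟨y, x, hy.1, h, hx.2, hpq⟩
  obtain ⟨N, hN⟩ := (hl.tendsto_sum.eventually_gt_atTop (V / η)).exists
  obtain ⟨a, b, hab, hab'⟩ := exists_large_oscillations hosc N δ hδ
  have h1 := hf N a b hab
  have h2 : η * ∑ i ∈ Finset.range N, 1 / lam i
      ≤ ∑ i ∈ Finset.range N, |f (b i) - f (a i)| / lam i := by
    rw [Finset.mul_sum]
    refine Finset.sum_le_sum fun i hi => ?_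
    rw [mul_one_div]
    exact div_le_div_of_nonneg_right (hab' i (Finset.mem_range.1 hi)) (hl.pos i).le
  rw [div_lt_iff₀ hη] at hN
  linarith

/-- A function of bounded `Λ`-variation with a limit at `0+` has small `Λ`-variation near `0+`. -/
lemma VariationLE.exists_small {lam : ℕ → ℝ} (hl : IsWatermanSeq lam) {δ V : ℝ} (hδ : 0 < δ)
    {f : ℝ → ℝ} (hf : VariationLE lam δ V f) {L : ℝ} (hL : Tendsto f (𝓝[>] 0) (𝓝 L))
    {ε : ℝ} (hε : 0 < ε) : ∃ δ' > 0, VariationLE lam δ' ε f := by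
  by_contra! hcon
  set S : Set ℝ := {s | ∃ N a b, IsFamilyIn δ N a b ∧
    s = ∑ i ∈ Finset.range N, |f (b i) - f (a i)| / lam i} with hS
  have hbdd : BddAbove S := ⟨V, by rintro s ⟨N, a, b, hab, rfl⟩; exact hf N a b hab⟩
  have hne : S.Nonempty := ⟨_, 0, 0, 0, ⟨by simp, by simp, by simp, by simp⟩, rfl⟩
  -- A nearly optimal family of `p` intervals, all to the right of some `m > 0`. If variation above
  -- `ε` persisted near `0`, grafting the tail of a family lying left of `m` onto it would beat the
  -- supremum.
  obtain ⟨s, ⟨p, a, b, hab, rfl⟩, hs⟩ := exists_lt_of_lt_csSup hne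
    (show sSup S - ε / 4 < sSup S by linarith)
  obtain ⟨m, hm0, hm⟩ : ∃ m > 0, ∀ i < p, m ≤ a i := by
    rcases Nat.eq_zero_or_pos p with rfl | hp
    · exact ⟨1, one_pos, by simp⟩
    · obtain ⟨i, hi, hmin⟩ := (Finset.range p).exists_min_image a ⟨0, by simpa using hp⟩
      exact ⟨a i, hab.pos i (by simpa using hi), fun j hj => hmin j (by simpa using hj)⟩
  set H := ∑ i ∈ Finset.range p, 1 / lam i with hH
  have hH0 : 0 ≤ H := Finset.sum_nonneg fun i _ => (one_div_pos.2 (hl.pos i)).le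
  -- Chosen so that the first `p` weights applied to oscillations of size `2η` cost at most `ε/4`.
  set η := ε / (8 * (H + 1)) with hη
  have hη0 : 0 < η := by positivity
  have hev := (Metric.tendsto_nhds.1 hL η hη0)
  obtain ⟨δ₁, hδ₁, hδ₁'⟩ := mem_nhdsGT_iff_exists_Ioo_subset.1 hev
  have hδ₁ : 0 < δ₁ := hδ₁
  have hmin : 0 < min δ (min δ₁ m) := lt_min hδ (lt_min hδ₁ hm0)
  have hneg := hcon _ hmin
  unfold VariationLE at hneg
  push Not at hneg
  obtain ⟨q, c, d, hcd, hsum⟩ := hneg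
  have hosc : ∀ i < q, |f (d i) - f (c i)| ≤ 2 * η := by
    intro i hi
    have h0 := hcd.pos i hi
    have h1 := hcd.lt i hi
    have h2 := (hcd.right_lt i hi).trans_le ((min_le_right _ _).trans (min_le_left _ _))
    have h3 : dist (f (d i)) L < η := hδ₁' ⟨h0.trans h1, h2⟩
    have h4 : dist (f (c i)) L < η := hδ₁' ⟨h0, h1.trans h2⟩
    have := dist_triangle_right (f (d i)) (f (c i)) L
    rw [← Real.dist_eq]
    linarith
  have hsmall : ∀ k ≤ p, k ≤ q →
      ∑ i ∈ Finset.range k, |f (d i) - f (c i)| / lam i ≤ ε / 4 := by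
    intro k hk hkq
    calc ∑ i ∈ Finset.range k, |f (d i) - f (c i)| / lam i
        ≤ ∑ i ∈ Finset.range k, 2 * η * (1 / lam i) := by
          refine Finset.sum_le_sum fun i hi => ?_
          rw [mul_one_div]
          exact div_le_div_of_nonneg_right
            (hosc i ((Finset.mem_range.1 hi).trans_le hkq)) (hl.pos i).le
      _ = 2 * η * ∑ i ∈ Finset.range k, 1 / lam i := by rw [Finset.mul_sum]
      _ ≤ 2 * η * H := by
          refine mul_le_mul_of_nonneg_left ?_ (by positivity)
          exact Finset.sum_le_sum_of_subset_of_nonneg (by simpa using hk)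
            fun i _ _ => (one_div_pos.2 (hl.pos i)).le
      _ ≤ 2 * η * (H + 1) := by
          refine mul_le_mul_of_nonneg_left (by linarith) (by positivity)
      _ = ε / 4 := by rw [hη]; field_simp; norm_num
  have hpq : p ≤ q := by
    by_contra hlt
    have := hsmall q (by omega) le_rfl
    linarith
  have hkey : ∀ i < p, ∀ j < q, Disjoint (Set.Ioo (a i) (b i)) (Set.Ioo (c j) (d j)) :=
    fun i hi j hj => Set.disjoint_left.2 fun z hz hz' => by
      have h1 := (hcd.right_lt j hj).trans_le ((min_le_right _ _).trans (min_le_right _ _))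
      have h2 := hm i hi
      have := hz.1; have := hz'.2
      linarith
  -- Only the first `p` entries of `(c, d)` are replaced, so each remaining one keeps its index and
  -- weight. The spliced sum exceeds `(sSup S - ε/4) + (ε - ε/4)`.
  have hfam : IsFamilyIn δ q (fun i => if i < p then a i else c i)
      (fun i => if i < p then b i else d i) := by
    refine ⟨?_, ?_, ?_, ?_⟩
    · intro i hi'
      by_cases hi : i < p
      · simpa [hi] using hab.lt i hi
      · simpa [hi] using hcd.lt i hi'
    · intro i hi'
      by_cases hi : i < p
      · simpa [hi] using hab.pos i hi
      · simpa [hi] using hcd.pos i hi'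
    · intro i hi'
      by_cases hi : i < p
      · simpa [hi] using hab.right_lt i hi
      · simpa [hi] using (hcd.right_lt i hi').trans_le (min_le_left _ _)
    · intro i hi' j hj' hij
      by_cases hi : i < p <;> by_cases hj : j < p
      · simpa [hi, hj] using hab.disjoint i hi j hj hij
      · simpa [hi, hj] using hkey i hi j hj'
      · simpa [hi, hj] using (hkey j hj i hi').symm
      · simpa [hi, hj] using hcd.disjoint i hi' j hj' hij
  have hle := le_csSup hbdd ⟨q, _, _, hfam, rfl⟩
  rw [← Finset.sum_range_add_sum_Ico _ hpq] at hle hsum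
  have e1 : ∑ i ∈ Finset.range p, |f (if i < p then b i else d i) - f (if i < p then a i else c i)|
      / lam i = ∑ i ∈ Finset.range p, |f (b i) - f (a i)| / lam i :=
    Finset.sum_congr rfl fun i hi => by simp [Finset.mem_range.1 hi]
  have e2 : ∑ i ∈ Finset.Ico p q, |f (if i < p then b i else d i) - f (if i < p then a i else c i)|
      / lam i = ∑ i ∈ Finset.Ico p q, |f (d i) - f (c i)| / lam i :=
    Finset.sum_congr rfl fun i hi => by simp [(Finset.mem_Ico.1 hi).1.not_gt]
  have := hsmall p le_rfl hpq
  simp only [e1, e2] at hle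
  linarith

lemma LambdaBV.exists_bound {lam : ℕ → ℝ} {f : ℝ → ℝ} (hf : f ∈ LambdaBV lam) :
    ∃ V : ℝ, ∀ (N : ℕ) (a b : Fin N → ℝ), IsNonoverlapping a b →
      ∑ i : Fin N, |f (b i) - f (a i)| / lam i ≤ V := by
  refine ⟨(lambdaVariation lam f).toReal, fun N a b h => ?_⟩
  rw [← ENNReal.ofReal_le_iff_le_toReal hf.2.ne]
  exact le_iSup_of_le N (le_iSup_of_le a (le_iSup_of_le b (le_iSup_of_le h le_rfl)))

lemma mem_lambdaBV_of_bound {lam : ℕ → ℝ} {f : ℝ → ℝ}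
    (hf : Function.Periodic f (2 * Real.pi)) {V : ℝ}
    (h : ∀ (N : ℕ) (a b : Fin N → ℝ), IsNonoverlapping a b →
      ∑ i : Fin N, |f (b i) - f (a i)| / lam i ≤ V) : f ∈ LambdaBV lam := by
  refine ⟨hf, lt_of_le_of_lt (b := ENNReal.ofReal V) ?_ ENNReal.ofReal_lt_top⟩
  exact iSup_le fun N => iSup_le fun a => iSup_le fun b => iSup_le fun hab =>
    ENNReal.ofReal_le_ofReal (h N a b hab)

/-- Reducing `x` to `[0, 2π)` by periodicity leaves room on the right inside `[0, 2π]`; the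
left-hand version reduces to `(0, 2π]` for the same reason. -/
lemma LambdaBV.variationLE_right {lam : ℕ → ℝ} {g : ℝ → ℝ} (hg : g ∈ LambdaBV lam) (x : ℝ) :
    ∃ δ > 0, ∃ V, VariationLE lam δ V fun u => g (x + u) := by
  obtain ⟨V, hV⟩ := LambdaBV.exists_bound hg
  have hp : (0 : ℝ) < 2 * Real.pi := by positivity
  set y := toIcoMod hp 0 x with hy
  have hmem : y ∈ Set.Ico 0 (0 + 2 * Real.pi) := toIcoMod_mem_Ico hp 0 x
  have hper : ∀ u, g (x + u) = g (y + u) := fun u => by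
    have : x + u = y + u + toIcoDiv hp 0 x • (2 * Real.pi) := by
      rw [hy, ← self_sub_toIcoDiv_zsmul]; ring
    rw [this]; exact (hg.1.zsmul _) _
  refine ⟨2 * Real.pi - y, by linarith [hmem.2], V, fun N a b h => ?_⟩
  have := hV N (fun i => y + a i) (fun i => y + b i)
    ⟨fun i => by linarith [h.lt i i.2], fun i => by linarith [h.pos i i.2, hmem.1],
      fun i => by linarith [h.right_lt i i.2], fun i j hij => by
        have := h.disjoint i i.2 j j.2 (by simpa [Fin.ext_iff] using hij)
        rw [Set.disjoint_left] at this ⊢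
        intro z hz hz'
        exact @this (z - y) ⟨by linarith [hz.1], by linarith [hz.2]⟩
          ⟨by linarith [hz'.1], by linarith [hz'.2]⟩⟩
  simp only [hper]
  rwa [Fin.sum_univ_eq_sum_range (fun i => |g (y + b i) - g (y + a i)| / lam i) N] at this

lemma LambdaBV.variationLE_left {lam : ℕ → ℝ} {g : ℝ → ℝ} (hg : g ∈ LambdaBV lam) (x : ℝ) :
    ∃ δ > 0, ∃ V, VariationLE lam δ V fun u => g (x - u) := by
  obtain ⟨V, hV⟩ := LambdaBV.exists_bound hg
  have hp : (0 : ℝ) < 2 * Real.pi := by positivity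
  set y := toIocMod hp 0 x with hy
  have hmem : y ∈ Set.Ioc 0 (0 + 2 * Real.pi) := toIocMod_mem_Ioc hp 0 x
  have hper : ∀ u, g (x - u) = g (y - u) := fun u => by
    have : x - u = y - u + toIocDiv hp 0 x • (2 * Real.pi) := by
      rw [hy, ← self_sub_toIocDiv_zsmul]; ring
    rw [this]; exact (hg.1.zsmul _) _
  refine ⟨y, hmem.1, V, fun N a b h => ?_⟩
  have := hV N (fun i => y - b i) (fun i => y - a i)
    ⟨fun i => by linarith [h.lt i i.2], fun i => by linarith [h.right_lt i i.2],
      fun i => by linarith [h.pos i i.2, hmem.2], fun i j hij => by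
        have := h.disjoint i i.2 j j.2 (by simpa [Fin.ext_iff] using hij)
        rw [Set.disjoint_left] at this ⊢
        intro z hz hz'
        exact @this (y - z) ⟨by linarith [hz.2], by linarith [hz.1]⟩
          ⟨by linarith [hz'.2], by linarith [hz'.1]⟩⟩
  simp only [hper]
  rw [Fin.sum_univ_eq_sum_range (fun i => |g (y - a i) - g (y - b i)| / lam i) N] at this
  simpa only [abs_sub_comm] using this

lemma tendsto_nhdsGT_iff_add {g : ℝ → ℝ} {x L : ℝ} :
    Tendsto (fun u => g (x + u)) (𝓝[>] 0) (𝓝 L) ↔ Tendsto g (𝓝[>] x) (𝓝 L) := by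
  have : 𝓝[>] x = map (fun u => x + u) (𝓝[>] 0) := by
    simp
  rw [this, tendsto_map'_iff]; rfl

lemma tendsto_nhdsLT_iff_sub {g : ℝ → ℝ} {x L : ℝ} :
    Tendsto (fun u => g (x - u)) (𝓝[>] 0) (𝓝 L) ↔ Tendsto g (𝓝[<] x) (𝓝 L) := by
  have : 𝓝[<] x = map (fun u => x - u) (𝓝[>] 0) := by
    simp
  rw [this, tendsto_map'_iff]; rfl

lemma LambdaBV.exists_tendsto_right {lam : ℕ → ℝ} (hl : IsWatermanSeq lam) {g : ℝ → ℝ}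
    (hg : g ∈ LambdaBV lam) (x : ℝ) : ∃ L, Tendsto g (𝓝[>] x) (𝓝 L) := by
  obtain ⟨δ, hδ, V, hV⟩ := LambdaBV.variationLE_right hg x
  obtain ⟨L, hL⟩ := hV.exists_tendsto hl hδ
  exact ⟨L, tendsto_nhdsGT_iff_add.1 hL⟩

lemma LambdaBV.exists_tendsto_left {lam : ℕ → ℝ} (hl : IsWatermanSeq lam) {g : ℝ → ℝ}
    (hg : g ∈ LambdaBV lam) (x : ℝ) : ∃ L, Tendsto g (𝓝[<] x) (𝓝 L) := by
  obtain ⟨δ, hδ, V, hV⟩ := LambdaBV.variationLE_left hg x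
  obtain ⟨L, hL⟩ := hV.exists_tendsto hl hδ
  exact ⟨L, tendsto_nhdsLT_iff_sub.1 hL⟩

lemma LambdaBV.exists_abs_le {lam : ℕ → ℝ} (hl : IsWatermanSeq lam) {g : ℝ → ℝ}
    (hg : g ∈ LambdaBV lam) : ∃ C, ∀ x, |g x| ≤ C := by
  obtain ⟨V, hV⟩ := LambdaBV.exists_bound hg
  have hp : (0 : ℝ) < 2 * Real.pi := by positivity
  have key : ∀ y ∈ Set.Ico 0 (2 * Real.pi), |g y| ≤ |g 0| + |lam 0 * V| := by
    intro y hy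
    rcases hy.1.eq_or_lt with rfl | h0
    · linarith [abs_nonneg (lam 0 * V)]
    · have := hV 1 (fun _ => 0) (fun _ => y) ⟨fun _ => h0, fun _ => le_rfl, fun _ => hy.2.le,
        fun i j hij => absurd (Subsingleton.elim i j) hij⟩
      simp only [Finset.univ_unique, Fin.default_eq_zero, Fin.isValue, Fin.val_eq_zero,
        Finset.sum_const, Finset.card_singleton, one_smul] at this
      rw [div_le_iff₀' (hl.pos 0)] at this
      have h2 := abs_add_le (g y - g 0) (g 0)
      rw [sub_add_cancel] at h2
      linarith [le_abs_self (lam 0 * V)]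
  refine ⟨|g 0| + |lam 0 * V|, fun x => ?_⟩
  have hmem := toIcoMod_mem_Ico hp 0 x
  rw [zero_add] at hmem
  have := key _ hmem
  have e : g x = g (toIcoMod hp 0 x) := by
    conv_lhs => rw [← toIcoMod_add_toIcoDiv_zsmul hp 0 x]
    exact (hg.1.zsmul _) _
  rwa [e]

/-! ### Measurability, boundedness and square-summable coefficients -/

/-- At all but countably many points the right limit of a real function, if it exists, is at most
the value. -/
lemma countable_setOf_lt_right_limit (g G : ℝ → ℝ) (hG : ∀ x, Tendsto g (𝓝[>] x) (𝓝 (G x))) :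
    {x | g x < G x}.Countable := by
  -- Rationals separate `g x` from the values just to the right of `x`. Two points `x < y` in one
  -- piece would give both `g y < q.2` and `q.2 < g y`.
  have hsub : {x | g x < G x} ⊆
      ⋃ q : ℚ × ℚ, {x | x < q.1 ∧ g x < q.2 ∧ ∀ y ∈ Set.Ioo x q.1, (q.2 : ℝ) < g y} := by
    intro x hx
    obtain ⟨q, hq, hq'⟩ := exists_rat_btwn (show g x < G x from hx)
    obtain ⟨u, hu, hu'⟩ := mem_nhdsGT_iff_exists_Ioo_subset.1 ((hG x).eventually_const_lt hq')
    obtain ⟨p, hp, hp'⟩ := exists_rat_btwn (show x < u from hu)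
    exact Set.mem_iUnion.2 ⟨(p, q), hp, hq, fun y hy => hu' ⟨hy.1, hy.2.trans hp'⟩⟩
  refine (Set.countable_iUnion fun q => Set.Subsingleton.countable ?_).mono hsub
  rintro x ⟨hx, hx', hx''⟩ y ⟨hy, hy', hy''⟩
  rcases lt_trichotomy x y with h | h | h
  · exact absurd (hx'' y ⟨h, hy⟩) hy'.not_gt
  · exact h
  · exact absurd (hy'' x ⟨h, hx⟩) hx'.not_gt

/-- The right-limit function is a pointwise limit of samples of `g` at the next grid point strictly
to the right. Each sample factors through a floor, so it is measurable whatever `g` is; `g` differs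
from the limit only on a countable set. -/
lemma aemeasurable_of_tendsto_right {g : ℝ → ℝ} (hg : ∀ x, ∃ L, Tendsto g (𝓝[>] x) (𝓝 L)) :
    AEMeasurable g := by
  choose G hG using hg
  have hmeas : Measurable G := by
    refine measurable_of_tendsto_metrizable
      (f := fun (n : ℕ) x => g ((⌊x * (n + 1 : ℝ)⌋ + 1) / (n + 1 : ℝ))) (fun n => ?_) ?_
    · have h1 : Measurable fun k : ℤ => g ((k + 1) / (n + 1 : ℝ)) := measurable_from_top
      have h2 : Measurable fun x : ℝ => ⌊x * (n + 1 : ℝ)⌋ :=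
        (measurable_id.mul_const _).floor
      exact h1.comp h2
    · refine tendsto_pi_nhds.2 fun x => (hG x).comp ?_
      refine tendsto_nhdsWithin_iff.2 ⟨?_, Eventually.of_forall fun n => ?_⟩
      · have h0 : Tendsto (fun n : ℕ => x + 1 / ((n : ℝ) + 1)) atTop (𝓝 x) := by
          simpa using tendsto_const_nhds.add (tendsto_one_div_add_atTop_nhds_zero_nat (𝕜 := ℝ))
        refine tendsto_of_tendsto_of_tendsto_of_le_of_le tendsto_const_nhds h0 (fun n => ?_)
          fun n => ?_
        · have hn : (0 : ℝ) < n + 1 := by positivity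
          have := (Int.lt_floor_add_one (x * (n + 1 : ℝ))).le
          simp only
          rwa [le_div_iff₀ hn]
        · have hn : (0 : ℝ) < n + 1 := by positivity
          have := Int.floor_le (x * (n + 1 : ℝ))
          simp only
          rw [div_le_iff₀ hn, add_mul, one_div, inv_mul_cancel₀ hn.ne']
          linarith
      · have hn : (0 : ℝ) < n + 1 := by positivity
        rw [Set.mem_Ioi, lt_div_iff₀ hn]
        exact Int.lt_floor_add_one _
  refine ⟨G, hmeas, ?_⟩
  have h1 := countable_setOf_lt_right_limit g G hG
  have h2 := countable_setOf_lt_right_limit (fun x => -g x) (fun x => -G x) fun x => (hG x).neg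
  have h3 := (h1.union h2).ae_notMem MeasureTheory.volume
  filter_upwards [h3] with x hx
  simp only [Set.mem_union, Set.mem_ofPred_eq, not_or, not_lt, neg_le_neg_iff] at hx
  exact le_antisymm hx.2 hx.1

/-- Bounded, Lebesgue measurable, `2π`-periodic functions. -/
structure IsBoundedPeriodic (g : ℝ → ℝ) : Prop where
  periodic : Function.Periodic g (2 * Real.pi)
  aemeasurable : AEMeasurable g
  bounded : ∃ C, ∀ x, |g x| ≤ C

lemma LambdaBV.isBoundedPeriodic {lam : ℕ → ℝ} (hl : IsWatermanSeq lam) {g : ℝ → ℝ}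
    (hg : g ∈ LambdaBV lam) : IsBoundedPeriodic g :=
  ⟨hg.1, aemeasurable_of_tendsto_right (LambdaBV.exists_tendsto_right hl hg),
    LambdaBV.exists_abs_le hl hg⟩

lemma intervalIntegrable_of_abs_le {h : ℝ → ℝ} (hm : AEMeasurable h) {C : ℝ} (hC : ∀ x, |h x| ≤ C)
    (a b : ℝ) : IntervalIntegrable h MeasureTheory.volume a b := by
  rw [intervalIntegrable_iff]
  exact MeasureTheory.Measure.integrableOn_of_bounded (M := C) (by simp) hm.aestronglyMeasurable
    (Eventually.of_forall fun x => hC x)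

lemma intervalIntegrable_mul_of_abs_le {h w : ℝ → ℝ} (hm : AEMeasurable h) {C : ℝ}
    (hC : ∀ x, |h x| ≤ C) (hw : Measurable w) (hw1 : ∀ x, |w x| ≤ 1) (a b : ℝ) :
    IntervalIntegrable (fun x => h x * w x) MeasureTheory.volume a b :=
  intervalIntegrable_of_abs_le (hm.mul hw.aemeasurable) (C := C) (fun x => by
    rw [Pi.mul_apply, abs_mul]
    exact (mul_le_of_le_one_right (abs_nonneg _) (hw1 x)).trans (hC x)) a b

/-- Parseval for the complex coefficients, whose real and imaginary parts give the two integrals up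
to the factor `2π` and a sign. -/
lemma summable_sq_integral_cos_sin {h : ℝ → ℝ} (hm : AEMeasurable h) {C : ℝ}
    (hC : ∀ x, |h x| ≤ C) :
    (Summable fun k : ℕ => (∫ u in (-Real.pi)..Real.pi, h u * Real.cos (k * u)) ^ 2) ∧
    Summable fun k : ℕ => (∫ u in (-Real.pi)..Real.pi, h u * Real.sin (k * u)) ^ 2 := by
  have hab : -Real.pi < Real.pi := by linarith [Real.pi_pos]
  set f : ℝ → ℂ := fun x => (h x : ℂ) with hf
  have hL2 : MeasureTheory.MemLp f 2
      (MeasureTheory.volume.restrict (Set.Ioc (-Real.pi) Real.pi)) :=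
    MeasureTheory.MemLp.of_bound (Complex.measurable_ofReal.comp_aemeasurable
      hm).aestronglyMeasurable.restrict C (Eventually.of_forall fun x => by simpa [hf] using hC x)
  have hS := (hasSum_sq_fourierCoeffOn hab hL2).summable
  have hS' : Summable fun k : ℕ => (2 * Real.pi) ^ 2 * ‖fourierCoeffOn hab f (k : ℤ)‖ ^ 2 :=
    (hS.comp_injective (i := fun k : ℕ => (k : ℤ)) Nat.cast_injective).mul_left _
  have hI : ∀ k : ℕ, IntervalIntegrable (fun x : ℝ => Complex.exp (-(k * x * Complex.I)) * h x)
      MeasureTheory.volume (-Real.pi) Real.pi := fun k => by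
    refine IntervalIntegrable.continuousOn_mul ?_ (by fun_prop)
    have h0 := intervalIntegrable_of_abs_le hm hC (-Real.pi) Real.pi
    exact ⟨h0.1.ofReal, h0.2.ofReal⟩
  have key : ∀ k : ℕ, (2 * Real.pi : ℝ) * fourierCoeffOn hab f (k : ℤ) =
      ∫ x in (-Real.pi)..Real.pi, Complex.exp (-(k * x * Complex.I)) * h x := fun k => by
    have hpi : (Real.pi : ℂ) ≠ 0 := by exact_mod_cast Real.pi_ne_zero
    rw [fourierCoeffOn_eq_integral, Complex.real_smul, ← mul_assoc]
    have e : ((2 * Real.pi : ℝ) : ℂ) * ((1 / (Real.pi - -Real.pi) : ℝ) : ℂ) = 1 := by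
      push_cast; field_simp; norm_num
    rw [e, one_mul]
    refine intervalIntegral.integral_congr fun x _ => ?_
    simp only [fourier_coe_apply, smul_eq_mul, hf]
    congr 2
    push_cast
    field_simp
    ring
  have hre : ∀ k : ℕ, ∫ u in (-Real.pi)..Real.pi, h u * Real.cos (k * u) =
      ((2 * Real.pi : ℝ) * fourierCoeffOn hab f (k : ℤ)).re := fun k => by
    rw [key, ← Complex.reCLM_apply, ← Complex.reCLM.intervalIntegral_comp_comm (hI k)]
    refine intervalIntegral.integral_congr fun x _ => ?_
    have : (-(k * x * Complex.I) : ℂ) = ((-(k * x) : ℝ) : ℂ) * Complex.I := by push_cast; ring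
    rw [Complex.reCLM_apply, Complex.re_mul_ofReal, this, Complex.exp_ofReal_mul_I_re,
      Real.cos_neg, mul_comm]
  have him : ∀ k : ℕ, ∫ u in (-Real.pi)..Real.pi, h u * Real.sin (k * u) =
      -((2 * Real.pi : ℝ) * fourierCoeffOn hab f (k : ℤ)).im := fun k => by
    rw [key, ← Complex.imCLM_apply, ← Complex.imCLM.intervalIntegral_comp_comm (hI k),
      ← intervalIntegral.integral_neg]
    refine intervalIntegral.integral_congr fun x _ => ?_
    have : (-(k * x * Complex.I) : ℂ) = ((-(k * x) : ℝ) : ℂ) * Complex.I := by push_cast; ring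
    rw [Complex.imCLM_apply, Complex.im_mul_ofReal, this, Complex.exp_ofReal_mul_I_im,
      Real.sin_neg, neg_mul, neg_neg, mul_comm]
  have hnorm : ∀ k : ℕ, ‖((2 * Real.pi : ℝ) : ℂ) * fourierCoeffOn hab f (k : ℤ)‖ ^ 2 =
      (2 * Real.pi) ^ 2 * ‖fourierCoeffOn hab f (k : ℤ)‖ ^ 2 := fun k => by
    rw [norm_mul, mul_pow, Complex.norm_real, Real.norm_eq_abs, sq_abs]
  refine ⟨Summable.of_nonneg_of_le (fun _ => sq_nonneg _) (fun k => ?_) hS',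
    Summable.of_nonneg_of_le (fun _ => sq_nonneg _) (fun k => ?_) hS'⟩
  · rw [hre, ← hnorm, ← sq_abs]
    exact pow_le_pow_left₀ (abs_nonneg _) (Complex.abs_re_le_norm _) 2
  · rw [him, ← hnorm, neg_sq, ← sq_abs]
    exact pow_le_pow_left₀ (abs_nonneg _) (Complex.abs_im_le_norm _) 2

lemma tendsto_zero_of_summable_sq {x : ℕ → ℝ} (h : Summable fun k => x k ^ 2) :
    Tendsto x atTop (𝓝 0) := by
  have := h.tendsto_atTop_zero.sqrt
  simp only [Real.sqrt_sq_eq_abs, Real.sqrt_zero] at this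
  exact tendsto_zero_iff_abs_tendsto_zero _ |>.2 this

/-! ### Integrated Fourier terms and convergence of the tails -/

/-- The sine coefficients of `u ↦ g (x + u)`. -/
noncomputable def jumpCoeff (g : ℝ → ℝ) (x : ℝ) (k : ℕ) : ℝ :=
  1 / Real.pi * ∫ u in (-Real.pi)..Real.pi, g (x + u) * Real.sin (k * u)

/-- The sum of `k * jumpCoeff g x k` over `1 ≤ k ≤ n`. -/
noncomputable def jumpSum (g : ℝ → ℝ) (x : ℝ) (n : ℕ) : ℝ :=
  ∑ k ∈ Finset.range n, ((k + 1 : ℕ) : ℝ) * jumpCoeff g x (k + 1)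

lemma IsBoundedPeriodic.comp_add {g : ℝ → ℝ} (hg : IsBoundedPeriodic g) (x : ℝ) :
    IsBoundedPeriodic fun u => g (x + u) := by
  obtain ⟨C, hC⟩ := hg.bounded
  refine ⟨fun u => ?_, ?_, C, fun u => hC _⟩
  · simp only [← add_assoc]; exact hg.periodic _
  · exact hg.aemeasurable.comp_quasiMeasurePreserving
      (MeasureTheory.measurePreserving_add_left MeasureTheory.volume x).quasiMeasurePreserving

lemma jumpCoeff_eq {g : ℝ → ℝ} (hg : IsBoundedPeriodic g) (x : ℝ) (k : ℕ) :
    jumpCoeff g x k = fourierSin g k * Real.cos (k * x) - fourierCos g k * Real.sin (k * x) := by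
  obtain ⟨C, hC⟩ := hg.bounded
  set G : ℝ → ℝ := fun t => g t * Real.sin (k * (t - x)) with hG
  have hper : Function.Periodic G (2 * Real.pi) := fun t => by
    simp only [hG, hg.periodic t]
    congr 1
    rw [show (k : ℝ) * (t + 2 * Real.pi - x) = k * (t - x) + k * (2 * Real.pi) by ring]
    exact Real.sin_add_nat_mul_two_pi _ _
  have h1 : ∫ u in (-Real.pi)..Real.pi, g (x + u) * Real.sin (k * u) =
      ∫ t in (-Real.pi)..Real.pi, G t := by
    have e1 : ∫ u in (-Real.pi)..Real.pi, g (x + u) * Real.sin (k * u) =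
        ∫ u in (-Real.pi)..Real.pi, G (x + u) := by
      simp only [hG, add_sub_cancel_left]
    rw [e1, intervalIntegral.integral_comp_add_left]
    have := hper.intervalIntegral_add_eq (x + -Real.pi) (-Real.pi)
    rw [show x + -Real.pi + 2 * Real.pi = x + Real.pi by ring,
      show -Real.pi + 2 * Real.pi = Real.pi by ring] at this
    exact this
  have hs : IntervalIntegrable (fun t => g t * Real.sin (k * t)) MeasureTheory.volume
      (-Real.pi) Real.pi := intervalIntegrable_mul_of_abs_le hg.aemeasurable hC (by fun_prop)
        (fun _ => Real.abs_sin_le_one _) _ _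
  have hc : IntervalIntegrable (fun t => g t * Real.cos (k * t)) MeasureTheory.volume
      (-Real.pi) Real.pi := intervalIntegrable_mul_of_abs_le hg.aemeasurable hC (by fun_prop)
        (fun _ => Real.abs_cos_le_one _) _ _
  have h2 : ∫ t in (-Real.pi)..Real.pi, G t =
      (∫ t in (-Real.pi)..Real.pi, g t * Real.sin (k * t)) * Real.cos (k * x) -
      (∫ t in (-Real.pi)..Real.pi, g t * Real.cos (k * t)) * Real.sin (k * x) := by
    rw [← intervalIntegral.integral_mul_const, ← intervalIntegral.integral_mul_const,
      ← intervalIntegral.integral_sub (hs.mul_const _) (hc.mul_const _)]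
    refine intervalIntegral.integral_congr fun t _ => ?_
    simp only [hG, mul_sub, Real.sin_sub]
    ring
  rw [jumpCoeff, h1, h2, fourierSin, fourierCos]
  ring

lemma zeroMeanPrimitive_trig {k : ℕ} (hk : k ≠ 0) (A B : ℝ) :
    zeroMeanPrimitive (fun x => A * Real.cos (k * x) + B * Real.sin (k * x)) =
      fun x => -B / k * Real.cos (k * x) + A / k * Real.sin (k * x) := by
  have hk' : (k : ℝ) ≠ 0 := by exact_mod_cast hk
  have hd : ∀ A B x : ℝ, HasDerivAt (fun x : ℝ => -B / k * Real.cos (k * x) + A / k * Real.sin (k * x))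
      (A * Real.cos (k * x) + B * Real.sin (k * x)) x := fun A B x => by
    have h0 : HasDerivAt (fun x : ℝ => (k : ℝ) * x) k x := by
      simpa using (hasDerivAt_id x).const_mul (k : ℝ)
    refine ((h0.cos.const_mul (-B / k)).add (h0.sin.const_mul (A / k))).congr_deriv ?_
    field_simp
    ring
  have hi : ∀ A B a b : ℝ, ∫ t in a..b, (A * Real.cos (k * t) + B * Real.sin (k * t)) =
      (-B / k * Real.cos (k * b) + A / k * Real.sin (k * b)) -
      (-B / k * Real.cos (k * a) + A / k * Real.sin (k * a)) := fun A B a b =>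
    intervalIntegral.integral_eq_sub_of_hasDerivAt (fun x _ => hd A B x)
      (Continuous.intervalIntegrable (by fun_prop) _ _)
  have hs : Real.sin (k * Real.pi) = 0 := Real.sin_nat_mul_pi k
  have hmean : ∫ u in (-Real.pi)..Real.pi, ∫ t in (0 : ℝ)..u,
      (A * Real.cos (k * t) + B * Real.sin (k * t)) = 2 * Real.pi * (B / k) := by
    simp only [hi, mul_zero, Real.cos_zero, Real.sin_zero, mul_one, add_zero]
    rw [intervalIntegral.integral_sub (Continuous.intervalIntegrable (by fun_prop) _ _)
      intervalIntegrable_const, hi, intervalIntegral.integral_const]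
    simp only [mul_neg, Real.cos_neg, Real.sin_neg, hs, smul_eq_mul]
    ring
  funext x
  rw [zeroMeanPrimitive, hmean, hi]
  have := Real.pi_ne_zero
  simp only [mul_zero, Real.cos_zero, Real.sin_zero, mul_one, add_zero]
  field_simp
  ring

lemma iteratedPrimitive_trig {k : ℕ} (hk : k ≠ 0) (A B : ℝ) (r : ℕ) :
    iteratedPrimitive (2 * r + 1) (fun x => A * Real.cos (k * x) + B * Real.sin (k * x)) =
      fun x => (-1) ^ (r + 1) * (B * Real.cos (k * x) - A * Real.sin (k * x)) / k ^ (2 * r + 1) := by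
  have hk' : (k : ℝ) ≠ 0 := by exact_mod_cast hk
  induction r generalizing A B with
  | zero =>
    simp only [iteratedPrimitive, mul_zero, zero_add, Function.iterate_one,
      zeroMeanPrimitive_trig hk]
    funext x
    ring
  | succ r ih =>
    have : 2 * (r + 1) + 1 = (2 * r + 1) + 1 + 1 := by ring
    rw [iteratedPrimitive, this, Function.iterate_succ_apply, Function.iterate_succ_apply,
      zeroMeanPrimitive_trig hk, zeroMeanPrimitive_trig hk]
    refine (ih _ _).trans ?_
    funext x
    field_simp
    ring

lemma iteratedPrimitive_fourierTerm {g : ℝ → ℝ} (hg : IsBoundedPeriodic g) (r : ℕ) {k : ℕ}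
    (hk : k ≠ 0) (x : ℝ) : iteratedPrimitive (2 * r + 1) (fourierTerm g k) x =
      (-1) ^ (r + 1) * jumpCoeff g x k / k ^ (2 * r + 1) := by
  rw [jumpCoeff_eq hg]
  exact congrFun (iteratedPrimitive_trig hk (fourierCos g k) (fourierSin g k) r) x

/-- By Bessel and `|β_k| / k ≤ β_k² + 1/k²`, boundedness and measurability of `g` already suffice
for convergence. -/
lemma summable_iteratedPrimitive {g : ℝ → ℝ} (hg : IsBoundedPeriodic g) (r : ℕ) (x : ℝ) :
    Summable fun k => iteratedPrimitive (2 * r + 1) (fourierTerm g k) x := by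
  have hgx := hg.comp_add x
  obtain ⟨C, hC⟩ := hgx.bounded
  have h1 := ((summable_sq_integral_cos_sin hgx.aemeasurable hC).2.mul_left
    ((1 / Real.pi) ^ 2)).add (Real.summable_one_div_nat_pow.2 (one_lt_two))
  refine Summable.of_norm_bounded_eventually_nat h1 ?_
  filter_upwards [eventually_ge_atTop 1] with k hk
  rw [iteratedPrimitive_fourierTerm hg r (by omega), ← mul_pow, ← jumpCoeff, Real.norm_eq_abs,
    abs_div, abs_mul, abs_pow, abs_neg, abs_one, one_pow, one_mul, abs_pow, Nat.abs_cast]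
  have hk1 : (1 : ℝ) ≤ k := by exact_mod_cast hk
  have h2 : |jumpCoeff g x k| / (k : ℝ) ^ (2 * r + 1) ≤ |jumpCoeff g x k| * (1 / k) := by
    rw [mul_one_div]
    refine div_le_div_of_nonneg_left (abs_nonneg _) (by positivity) ?_
    exact le_self_pow₀ hk1 (by omega)
  have h3 : (1 : ℝ) / (k : ℝ) ^ 2 = (1 / k) ^ 2 := by ring
  rw [h3]
  nlinarith [sq_nonneg (|jumpCoeff g x k| - 1 / k), sq_abs (jumpCoeff g x k),
    sq_nonneg (jumpCoeff g x k), sq_nonneg (1 / (k : ℝ))]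

lemma tendsto_integratedPartialSum {g : ℝ → ℝ} (hg : IsBoundedPeriodic g) (r n : ℕ) (x : ℝ) :
    Tendsto (fun N => integratedPartialSum (2 * r + 1) g n N x) atTop
      (𝓝 (∑' k, iteratedPrimitive (2 * r + 1) (fourierTerm g (k + n)) x)) := by
  have hs := summable_iteratedPrimitive hg r x
  have h1 := ((summable_nat_add_iff n).2 hs).hasSum.tendsto_sum_nat
  rw [← tendsto_add_atTop_iff_nat n]
  refine h1.congr fun N => ?_
  rw [integratedPartialSum, Finset.sum_Ico_eq_sum_range, Nat.add_sub_cancel]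
  simp only [add_comm]

lemma tailConverges {g : ℝ → ℝ} (hg : IsBoundedPeriodic g) (r : ℕ) (x : ℝ) :
    TailConverges (2 * r + 1) g x := fun n => ⟨_, tendsto_integratedPartialSum hg r n x⟩

lemma integratedTail_eq {g : ℝ → ℝ} (hg : IsBoundedPeriodic g) (r n : ℕ) (x : ℝ) :
    integratedTail (2 * r + 1) g n x =
      ∑' k, iteratedPrimitive (2 * r + 1) (fourierTerm g (k + n)) x :=
  (tendsto_integratedPartialSum hg r n x).limUnder_eq

/-! ### Tails versus weighted means -/

/-- The Stolz–Cesàro theorem for quotients of null sequences. -/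
lemma tendsto_div_of_tendsto_sub_div_sub {Q v : ℕ → ℝ} {l : ℝ} (hv : StrictAnti v)
    (hv0 : Tendsto v atTop (𝓝 0)) (hQ0 : Tendsto Q atTop (𝓝 0))
    (h : Tendsto (fun n => (Q n - Q (n + 1)) / (v n - v (n + 1))) atTop (𝓝 l)) :
    Tendsto (fun n => Q n / v n) atTop (𝓝 l) := by
  have hpos : ∀ n, 0 < v n := fun n =>
    (hv.antitone.le_of_tendsto hv0 (n + 1)).trans_lt (hv n.lt_succ_self)
  rw [Metric.tendsto_atTop] at h ⊢
  intro ε hε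
  obtain ⟨N, hN⟩ := h (ε / 2) (half_pos hε)
  have hstep : ∀ n ≥ N, (l - ε / 2) * (v n - v (n + 1)) ≤ Q n - Q (n + 1) ∧
      Q n - Q (n + 1) ≤ (l + ε / 2) * (v n - v (n + 1)) := by
    intro n hn
    have h0 : 0 < v n - v (n + 1) := sub_pos.2 (hv n.lt_succ_self)
    have := hN n hn
    rw [Real.dist_eq, abs_lt] at this
    rw [← le_div_iff₀ h0, ← div_le_iff₀ h0]
    constructor <;> linarith
  have key : ∀ w : ℕ → ℝ, Tendsto w atTop (𝓝 0) →
      (∀ n ≥ N, w (n + 1) ≤ w n) → ∀ n ≥ N, 0 ≤ w n := by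
    intro w hw hmono n hn
    have ha : Antitone fun k => w (k + N) := antitone_nat_of_succ_le fun k => by
      have := hmono (k + N) (by omega)
      rwa [show k + 1 + N = k + N + 1 by ring]
    have := ha.le_of_tendsto ((tendsto_add_atTop_iff_nat N).2 hw) (n - N)
    simpa [Nat.sub_add_cancel hn] using this
  refine ⟨N, fun n hn => ?_⟩
  have h1 := key (fun n => (l + ε / 2) * v n - Q n)
    (by simpa using (hv0.const_mul (l + ε / 2)).sub hQ0)
    (fun n hn => by linarith [(hstep n hn).2]) n hn
  have h2 := key (fun n => Q n - (l - ε / 2) * v n)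
    (by simpa using hQ0.sub (hv0.const_mul (l - ε / 2)))
    (fun n hn => by linarith [(hstep n hn).1]) n hn
  have h3 : Q n / v n ≤ l + ε / 2 := by rw [div_le_iff₀ (hpos n)]; linarith
  have h4 : l - ε / 2 ≤ Q n / v n := by rw [le_div_iff₀ (hpos n)]; linarith
  rw [Real.dist_eq, abs_lt]
  constructor <;> linarith

lemma tsum_shift_succ {d : ℕ → ℝ} (hd : Summable d) (n : ℕ) :
    ∑' k, d (k + n) = d n + ∑' k, d (k + (n + 1)) := by
  rw [((summable_nat_add_iff n).2 hd).tsum_eq_zero_add]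
  simp only [zero_add, add_assoc, add_comm 1 n]

/-- The differences of `Q n = R_{n+1} + σ_n / (n+1)^(s+1)` involve only `σ_{n+1}` and a difference
of powers. Stolz–Cesàro against `v n = (n+1)^(-s)` gives the limit `L (s+1)/s`; removing the
correction, which contributes `L`, leaves `L/s`. -/
lemma tendsto_pow_mul_tail {s : ℕ} (hs : s ≠ 0) {d : ℕ → ℝ} (hd : Summable d) {L : ℝ}
    (h : Tendsto (fun n : ℕ => (∑ k ∈ Finset.range n, ((k + 1 : ℕ) : ℝ) ^ (s + 1) * d (k + 1)) / n)
      atTop (𝓝 L)) :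
    Tendsto (fun n : ℕ => (n : ℝ) ^ s * ∑' k, d (k + n)) atTop (𝓝 (L / s)) := by
  set σ : ℕ → ℝ := fun n => ∑ k ∈ Finset.range n, ((k + 1 : ℕ) : ℝ) ^ (s + 1) * d (k + 1) with hσ
  set Q : ℕ → ℝ := fun n => (∑' k, d (k + (n + 1))) + σ n / ((n + 1 : ℕ) : ℝ) ^ (s + 1) with hQ
  set v : ℕ → ℝ := fun n => 1 / ((n + 1 : ℕ) : ℝ) ^ s with hv
  have hs' : (s : ℝ) ≠ 0 := by exact_mod_cast hs
  have hinv : Tendsto (fun n : ℕ => 1 / ((n + 1 : ℕ) : ℝ)) atTop (𝓝 0) := by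
    simpa using (tendsto_one_div_add_atTop_nhds_zero_nat (𝕜 := ℝ))
  have hq : Tendsto (fun n : ℕ => ((n : ℝ) + 1) / (n + 2)) atTop (𝓝 1) := by
    have h1 := (tendsto_const_nhds (x := (1 : ℝ))).sub ((tendsto_add_atTop_iff_nat 1).2 hinv)
    rw [sub_zero] at h1
    refine h1.congr fun n => ?_
    push_cast
    field_simp
    ring
  have hratio : Tendsto (fun n : ℕ => (n : ℝ) / (n + 1)) atTop (𝓝 1) := by
    have h1 := (tendsto_const_nhds (x := (1 : ℝ))).sub hinv
    rw [sub_zero] at h1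
    refine h1.congr fun n => ?_
    push_cast
    field_simp
    ring
  have hσ' : Tendsto (fun n : ℕ => σ n / ((n + 1 : ℕ) : ℝ)) atTop (𝓝 L) := by
    have := h.mul hratio
    rw [mul_one] at this
    refine this.congr fun n => ?_
    rcases Nat.eq_zero_or_pos n with rfl | hn
    · simp [hσ]
    · simp only [hσ]; push_cast; field_simp
  have hvanti : StrictAnti v := strictAnti_nat_of_succ_lt fun n => by
    simp only [hv]
    refine one_div_lt_one_div_of_lt (by positivity) ?_
    exact pow_lt_pow_left₀ (by push_cast; linarith) (by positivity) hs
  have hv0 : Tendsto v atTop (𝓝 0) := by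
    have := hinv.pow s
    rw [zero_pow hs] at this
    simpa [hv] using this
  have hR0 : Tendsto (fun n => ∑' k, d (k + n)) atTop (𝓝 0) := tendsto_sum_nat_add d
  have hQ0 : Tendsto Q atTop (𝓝 0) := by
    have h1 := ((tendsto_add_atTop_iff_nat 1).2 hR0).add (hσ'.mul hv0)
    rw [mul_zero, add_zero] at h1
    refine h1.congr fun n => ?_
    simp only [hQ, hv, pow_succ]
    field_simp
  -- With `q = (n+1)/(n+2) → 1`, the quotient is `σ_{n+1}/(n+1)` times `(1 - q^(s+1))/(1 - q^s)`, a
  -- ratio of geometric sums with `s+1` and `s` terms.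
  have hmain : Tendsto (fun n => (Q n - Q (n + 1)) / (v n - v (n + 1))) atTop
      (𝓝 (L * ((s + 1 : ℕ) / s))) := by
    have hg : ∀ j : ℕ, Tendsto (fun n : ℕ => ∑ i ∈ Finset.range j, (((n : ℝ) + 1) / (n + 2)) ^ i)
        atTop (𝓝 j) := fun j => by
      simpa using tendsto_finsetSum (Finset.range j) fun i _ => hq.pow i
    have h1 := ((tendsto_add_atTop_iff_nat 1).2 h).mul ((hg (s + 1)).div (hg s) hs')
    refine h1.congr fun n => ?_
    set q : ℝ := ((n : ℝ) + 1) / (n + 2) with hqdef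
    have hq1 : q < 1 := by rw [hqdef, div_lt_one (by positivity)]; linarith
    have hq0 : 0 < q := by positivity
    have hgs : ∀ j, ∑ i ∈ Finset.range j, q ^ i = (1 - q ^ j) / (1 - q) := fun j => by
      rw [geom_sum_eq hq1.ne, ← neg_div_neg_eq]; ring
    have hn1 : ((n : ℝ) + 1) ≠ 0 := by positivity
    have hn2 : ((n : ℝ) + 2) ≠ 0 := by positivity
    have hm : ∀ j : ℕ, 1 / ((n : ℝ) + 1) ^ j - 1 / ((n : ℝ) + 2) ^ j =
        (1 - q ^ j) / ((n : ℝ) + 1) ^ j := fun j => by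
      rw [hqdef, div_pow]; field_simp
    have hvd : v n - v (n + 1) = (1 - q ^ s) / ((n : ℝ) + 1) ^ s := by
      rw [← hm]; simp only [hv]; push_cast; ring
    have hQd : Q n - Q (n + 1) = σ (n + 1) * ((1 - q ^ (s + 1)) / ((n : ℝ) + 1) ^ (s + 1)) := by
      rw [← hm]
      simp only [hQ]
      rw [tsum_shift_succ hd (n + 1)]
      have e : σ (n + 1) = σ n + ((n + 1 : ℕ) : ℝ) ^ (s + 1) * d (n + 1) := by
        simp only [hσ]; rw [Finset.sum_range_succ]
      rw [e]
      push_cast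
      rw [show (n : ℝ) + 1 + 1 = n + 2 by ring]
      field_simp
      ring
    have hqs : 1 - q ^ s ≠ 0 := (sub_pos.2 (pow_lt_one₀ hq0.le hq1 hs)).ne'
    have hq1' : 1 - q ≠ 0 := (sub_pos.2 hq1).ne'
    rw [hvd, hQd]
    simp only [Pi.div_apply, ← hqdef, hgs, hσ]
    push_cast
    field_simp
    ring
  have hfin := (tendsto_div_of_tendsto_sub_div_sub hvanti hv0 hQ0 hmain).sub hσ'
  rw [← tendsto_add_atTop_iff_nat 1]
  have e : L * (((s + 1 : ℕ) : ℝ) / s) - L = L / s := by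
    push_cast; field_simp; ring
  rw [e] at hfin
  refine hfin.congr fun n => ?_
  simp only [hQ, hv]
  field_simp
  ring

lemma succ_pow_sub_pow_le (n p : ℕ) :
    ((n : ℝ) + 1) ^ (p + 1) - (n : ℝ) ^ (p + 1) ≤ (p + 1) * ((n : ℝ) + 1) ^ p := by
  induction p with
  | zero => simp
  | succ p ih =>
    have h1 : (n : ℝ) ^ (p + 1) ≤ ((n : ℝ) + 1) ^ (p + 1) :=
      pow_le_pow_left₀ (by positivity) (by linarith) _
    have h2 := mul_le_mul_of_nonneg_left ih (show (0 : ℝ) ≤ (n : ℝ) + 1 by positivity)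
    have e1 : ((n : ℝ) + 1) * (((n : ℝ) + 1) ^ (p + 1) - (n : ℝ) ^ (p + 1)) + (n : ℝ) ^ (p + 1) =
      ((n : ℝ) + 1) ^ (p + 1 + 1) - (n : ℝ) ^ (p + 1 + 1) := by ring
    have e2 : ((n : ℝ) + 1) * ((p + 1) * ((n : ℝ) + 1) ^ p) = (p + 1) * ((n : ℝ) + 1) ^ (p + 1) := by
      ring
    push_cast
    linarith

/-- Abel summation in the other direction: with `R` the tails of `d`, adding `n^(s+1) R_{n+1}` to
the weighted sum gives a sum of `((k+1)^(s+1) - k^(s+1)) R_{k+1}`, each term being at most `(s+1) M`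
in size. -/
lemma abs_weighted_sum_le_of_tail {s : ℕ} {d : ℕ → ℝ} (hd : Summable d) {M : ℝ}
    (h : ∀ n : ℕ, |(n : ℝ) ^ s * ∑' k, d (k + n)| ≤ M) (n : ℕ) :
    |∑ k ∈ Finset.range n, ((k + 1 : ℕ) : ℝ) ^ (s + 1) * d (k + 1)| ≤ (s + 2) * M * n := by
  have hM : 0 ≤ M := (abs_nonneg _).trans (h 0)
  set R : ℕ → ℝ := fun n => ∑' k, d (k + n) with hR
  have hRsucc : ∀ n : ℕ, ((n : ℝ) + 1) ^ s * |R (n + 1)| ≤ M := fun n => by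
    have := h (n + 1)
    rw [abs_mul, abs_of_nonneg (by positivity)] at this
    exact_mod_cast this
  have hP : |(∑ k ∈ Finset.range n, ((k + 1 : ℕ) : ℝ) ^ (s + 1) * d (k + 1)) +
      (n : ℝ) ^ (s + 1) * R (n + 1)| ≤ (s + 1) * M * n := by
    induction n with
    | zero => simp
    | succ n ih =>
      have e : (∑ k ∈ Finset.range (n + 1), ((k + 1 : ℕ) : ℝ) ^ (s + 1) * d (k + 1)) +
          ((n + 1 : ℕ) : ℝ) ^ (s + 1) * R (n + 1 + 1) =
          ((∑ k ∈ Finset.range n, ((k + 1 : ℕ) : ℝ) ^ (s + 1) * d (k + 1)) +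
          (n : ℝ) ^ (s + 1) * R (n + 1)) +
          (((n : ℝ) + 1) ^ (s + 1) - (n : ℝ) ^ (s + 1)) * R (n + 1) := by
        rw [Finset.sum_range_succ]
        have : R (n + 1) = d (n + 1) + R (n + 1 + 1) := tsum_shift_succ hd (n + 1)
        rw [this]
        push_cast
        ring
      rw [e]
      refine (abs_add_le _ _).trans ?_
      have h0 : 0 ≤ ((n : ℝ) + 1) ^ (s + 1) - (n : ℝ) ^ (s + 1) :=
        sub_nonneg.2 (pow_le_pow_left₀ (by positivity) (by linarith) _)
      have h1 : |(((n : ℝ) + 1) ^ (s + 1) - (n : ℝ) ^ (s + 1)) * R (n + 1)| ≤ (s + 1) * M := by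
        rw [abs_mul, abs_of_nonneg h0]
        calc _ ≤ ((s + 1) * ((n : ℝ) + 1) ^ s) * |R (n + 1)| :=
              mul_le_mul_of_nonneg_right (succ_pow_sub_pow_le n s) (abs_nonneg _)
          _ = (s + 1) * (((n : ℝ) + 1) ^ s * |R (n + 1)|) := by ring
          _ ≤ (s + 1) * M := mul_le_mul_of_nonneg_left (hRsucc n) (by positivity)
      rw [Nat.cast_succ, mul_add, mul_one]
      exact add_le_add ih h1
  have h2 : |(n : ℝ) ^ (s + 1) * R (n + 1)| ≤ M * n := by
    rw [abs_mul, abs_of_nonneg (by positivity), pow_succ, mul_right_comm]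
    refine mul_le_mul_of_nonneg_right (le_trans ?_ (hRsucc n)) (by positivity)
    exact mul_le_mul_of_nonneg_right (pow_le_pow_left₀ (by positivity) (by linarith) _)
      (abs_nonneg _)
  have h3 := abs_sub ((∑ k ∈ Finset.range n, ((k + 1 : ℕ) : ℝ) ^ (s + 1) * d (k + 1)) +
      (n : ℝ) ^ (s + 1) * R (n + 1)) ((n : ℝ) ^ (s + 1) * R (n + 1))
  rw [add_sub_cancel_right] at h3
  linarith

/-- The weight `k^(2r+2)` cancels the `k^(2r+1)` from integration, so every order `r` leads to the
same sum up to sign. -/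
lemma weighted_sum_eq_jumpSum {g : ℝ → ℝ} (hg : IsBoundedPeriodic g) (r n : ℕ) (x : ℝ) :
    ∑ k ∈ Finset.range n, ((k + 1 : ℕ) : ℝ) ^ (2 * r + 1 + 1) *
      iteratedPrimitive (2 * r + 1) (fourierTerm g (k + 1)) x = (-1) ^ (r + 1) * jumpSum g x n := by
  rw [jumpSum, Finset.mul_sum]
  refine Finset.sum_congr rfl fun k _ => ?_
  rw [iteratedPrimitive_fourierTerm hg r k.succ_ne_zero]
  have : ((k + 1 : ℕ) : ℝ) ≠ 0 := by positivity
  rw [Nat.succ_eq_add_one]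
  field_simp
  ring

lemma jumpFormula_of_tendsto {g : ℝ → ℝ} (hg : IsBoundedPeriodic g) {x gp gm : ℝ}
    (h : Tendsto (fun n : ℕ => jumpSum g x n / n) atTop (𝓝 ((gp - gm) / Real.pi))) (r : ℕ) :
    JumpFormula r g x gp gm := by
  have h1 := tendsto_pow_mul_tail (s := 2 * r + 1) (by omega) (summable_iteratedPrimitive hg r x)
    (L := (-1) ^ (r + 1) * ((gp - gm) / Real.pi)) (by
      simp only [weighted_sum_eq_jumpSum hg, mul_div_assoc]
      exact h.const_mul _)
  simp only [JumpFormula, integratedTail_eq hg]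
  convert h1 using 2
  push_cast
  have := Real.pi_ne_zero
  field_simp

lemma JumpFormula.exists_abs_jumpSum_le {g : ℝ → ℝ} (hg : IsBoundedPeriodic g) {x gp gm : ℝ}
    {r : ℕ} (h : JumpFormula r g x gp gm) : ∃ C, ∀ n : ℕ, |jumpSum g x n| ≤ C * n := by
  simp only [JumpFormula, integratedTail_eq hg] at h
  obtain ⟨M, hM⟩ := h.abs.bddAbove_range
  have := abs_weighted_sum_le_of_tail (s := 2 * r + 1) (summable_iteratedPrimitive hg r x)
    (fun n => hM (Set.mem_range_self n))
  refine ⟨((2 * r + 1 : ℕ) + 2) * M, fun n => ?_⟩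
  have h1 := this n
  rwa [weighted_sum_eq_jumpSum hg, abs_mul, abs_pow, abs_neg, abs_one, one_pow, one_mul] at h1

/-! ### The jump kernel -/

/-- The kernel `(1 / n) ∑ k sin (k u)`, the sum being over `1 ≤ k ≤ n`. -/
noncomputable def jumpKernel (n : ℕ) (u : ℝ) : ℝ :=
  (∑ k ∈ Finset.range n, ((k + 1 : ℕ) : ℝ) * Real.sin ((k + 1 : ℕ) * u)) / n

lemma continuous_jumpKernel (n : ℕ) : Continuous (jumpKernel n) := by
  unfold jumpKernel; fun_prop

lemma jumpKernel_neg (n : ℕ) (u : ℝ) : jumpKernel n (-u) = -jumpKernel n u := by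
  simp only [jumpKernel, mul_neg, Real.sin_neg, Finset.sum_neg_distrib, neg_div]

lemma abs_jumpKernel_le (n : ℕ) (u : ℝ) : |jumpKernel n u| ≤ n := by
  rcases Nat.eq_zero_or_pos n with rfl | hn
  · simp [jumpKernel]
  have hn' : (0 : ℝ) < n := by exact_mod_cast hn
  rw [jumpKernel, abs_div, Nat.abs_cast, div_le_iff₀ hn']
  calc _ ≤ ∑ k ∈ Finset.range n, |((k + 1 : ℕ) : ℝ) * Real.sin ((k + 1 : ℕ) * u)| :=
        Finset.abs_sum_le_sum_abs _ _
    _ ≤ ∑ _k ∈ Finset.range n, (n : ℝ) := by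
        refine Finset.sum_le_sum fun k hk => ?_
        rw [abs_mul, Nat.abs_cast]
        have h1 : ((k + 1 : ℕ) : ℝ) ≤ n := by exact_mod_cast Finset.mem_range.1 hk
        exact (mul_le_of_le_one_right (by positivity) (Real.abs_sin_le_one _)).trans h1
    _ = n * n := by simp

lemma sum_mul_sin (n : ℕ) (u : ℝ) :
    (∑ k ∈ Finset.range n, ((k + 1 : ℕ) : ℝ) * Real.sin ((k + 1 : ℕ) * u)) *
      (2 * (1 - Real.cos u)) = (n + 1) * Real.sin (n * u) - n * Real.sin ((n + 1) * u) := by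
  induction n with
  | zero => simp
  | succ n ih =>
    rw [Finset.sum_range_succ, add_mul, ih]
    push_cast
    have e1 : Real.sin ((n + 1 + 1) * u) =
        Real.sin ((n + 1) * u) * Real.cos u + Real.cos ((n + 1) * u) * Real.sin u := by
      rw [← Real.sin_add]; ring_nf
    have e2 : Real.sin (n * u) =
        Real.sin ((n + 1) * u) * Real.cos u - Real.cos ((n + 1) * u) * Real.sin u := by
      rw [← Real.sin_sub]; ring_nf
    rw [e1, e2]
    ring

/-- Half the cotangent of `u / 2`. -/
noncomputable def halfCot (u : ℝ) : ℝ := Real.cos (u / 2) / (2 * Real.sin (u / 2))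

lemma sin_half_pos {u : ℝ} (h0 : 0 < u) (h1 : u ≤ Real.pi) : 0 < Real.sin (u / 2) :=
  Real.sin_pos_of_pos_of_lt_pi (by linarith) (by linarith [Real.pi_pos])

lemma one_sub_cos_eq (u : ℝ) : 1 - Real.cos u = 2 * Real.sin (u / 2) ^ 2 := by
  have := Real.cos_two_mul (u / 2)
  rw [show 2 * (u / 2) = u by ring] at this
  rw [this, Real.cos_sq']; ring

lemma one_sub_cos_pos {u : ℝ} (h0 : 0 < u) (h1 : u ≤ Real.pi) : 0 < 1 - Real.cos u := by
  rw [one_sub_cos_eq]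
  have := sin_half_pos h0 h1
  positivity

/-- On scales `u ≥ π/n` the first term is integrable with a bound uniform in `n` and the second is
bounded. The cotangent term is the one that is not absolutely controlled and needs cancellation. -/
lemma jumpKernel_eq {n : ℕ} (hn : n ≠ 0) {u : ℝ} (h0 : 0 < u) (h1 : u ≤ Real.pi) :
    jumpKernel n u = 1 / n * (1 / (2 * (1 - Real.cos u)) * Real.sin (n * u))
      + 1 / 2 * Real.sin (n * u) - halfCot u * Real.cos (n * u) := by
  have hn' : (n : ℝ) ≠ 0 := by exact_mod_cast hn
  have hc := one_sub_cos_pos h0 h1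
  have hs := (sin_half_pos h0 h1).ne'
  have h2 := sum_mul_sin n u
  rw [← eq_div_iff (by positivity)] at h2
  have e1 : Real.sin ((n + 1) * u) =
        Real.sin (n * u) * Real.cos u + Real.cos (n * u) * Real.sin u := by
      rw [← Real.sin_add]; ring_nf
  have e2 : halfCot u = Real.sin u / (2 * (1 - Real.cos u)) := by
    have : Real.sin u = 2 * Real.sin (u / 2) * Real.cos (u / 2) := by
      rw [← Real.sin_two_mul]; ring_nf
    rw [halfCot, one_sub_cos_eq, this]
    field_simp
  rw [jumpKernel, h2, e1, e2]
  have hc' := hc.ne'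
  field_simp
  ring

lemma halfCot_nonneg {u : ℝ} (h0 : 0 < u) (h1 : u ≤ Real.pi) : 0 ≤ halfCot u :=
  div_nonneg (Real.cos_nonneg_of_mem_Icc ⟨by linarith, by linarith⟩)
    (by linarith [sin_half_pos h0 h1])

lemma halfCot_anti {u v : ℝ} (h0 : 0 < u) (huv : u ≤ v) (h1 : v ≤ Real.pi) :
    halfCot v ≤ halfCot u := by
  refine div_le_div₀ (Real.cos_nonneg_of_mem_Icc ⟨by linarith, by linarith⟩) ?_
    (by linarith [sin_half_pos h0 (huv.trans h1)]) ?_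
  · exact Real.cos_le_cos_of_nonneg_of_le_pi (by linarith) (by linarith) (by linarith)
  · have := Real.sin_le_sin_of_le_of_le_pi_div_two (x := u / 2) (y := v / 2) (by linarith)
      (by linarith) (by linarith)
    linarith

lemma halfCot_le {u : ℝ} (h0 : 0 < u) (h1 : u ≤ Real.pi) : halfCot u ≤ 1 / u := by
  have hs := sin_half_pos h0 h1
  rw [halfCot, div_le_div_iff₀ (by positivity) h0]
  rcases h1.eq_or_lt with rfl | h1
  · rw [Real.cos_pi_div_two]; linarith
  · have hc : 0 < Real.cos (u / 2) := Real.cos_pos_of_mem_Ioo ⟨by linarith, by linarith⟩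
    have := Real.lt_tan (x := u / 2) (by linarith) (by linarith)
    rw [Real.tan_eq_sin_div_cos, lt_div_iff₀ hc] at this
    linarith

lemma continuousOn_halfCot {s : Set ℝ} (hs : s ⊆ Set.Ioc 0 Real.pi) : ContinuousOn halfCot s := by
  unfold halfCot
  refine ContinuousOn.div (by fun_prop) (by fun_prop) fun x hx => ?_
  have := sin_half_pos (hs hx).1 (hs hx).2
  positivity

lemma continuousOn_inv_one_sub_cos {s : Set ℝ} (hs : s ⊆ Set.Ioc 0 Real.pi) :
    ContinuousOn (fun u => 1 / (2 * (1 - Real.cos u))) s := by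
  refine ContinuousOn.div (by fun_prop) (by fun_prop) fun x hx => ?_
  have := one_sub_cos_pos (hs hx).1 (hs hx).2
  positivity

lemma inv_one_sub_cos_le {u : ℝ} (h0 : 0 < u) (h1 : u ≤ Real.pi) :
    1 / (2 * (1 - Real.cos u)) ≤ Real.pi ^ 2 / 4 * (1 / u ^ 2) := by
  have h2 := Real.mul_le_sin (x := u / 2) (by linarith) (by linarith)
  have h3 : 2 / Real.pi * (u / 2) = u / Real.pi := by ring
  rw [h3] at h2
  have hpi := Real.pi_pos
  have h4 : (u / Real.pi) ^ 2 ≤ Real.sin (u / 2) ^ 2 := pow_le_pow_left₀ (by positivity) h2 2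
  rw [one_sub_cos_eq]
  calc 1 / (2 * (2 * Real.sin (u / 2) ^ 2)) ≤ 1 / (2 * (2 * (u / Real.pi) ^ 2)) := by
        apply one_div_le_one_div_of_le (by positivity); linarith
    _ = Real.pi ^ 2 / 4 * (1 / u ^ 2) := by field_simp; norm_num

/-- Each `k sin(ku)` integrates to `1 - (-1)^k` over `[0, π]`, and these numbers have mean `1` in
the limit. -/
lemma tendsto_integral_jumpKernel :
    Tendsto (fun n => ∫ u in (0 : ℝ)..Real.pi, jumpKernel n u) atTop (𝓝 1) := by
  have h1 : ∀ n : ℕ, ∫ u in (0 : ℝ)..Real.pi, jumpKernel n u =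
      (∑ k ∈ Finset.range n, (1 + (-1 : ℝ) ^ k)) / n := fun n => by
    simp only [jumpKernel]
    rw [intervalIntegral.integral_div, intervalIntegral.integral_finsetSum
      fun k _ => Continuous.intervalIntegrable (by fun_prop) _ _]
    congr 1
    refine Finset.sum_congr rfl fun k _ => ?_
    have hk : ((k + 1 : ℕ) : ℝ) ≠ 0 := by positivity
    rw [intervalIntegral.integral_const_mul, intervalIntegral.integral_comp_mul_left
      (fun x => Real.sin x) hk, integral_sin, mul_zero, Real.cos_zero, Real.cos_nat_mul_pi,
      smul_eq_mul, pow_succ, ← mul_assoc, mul_inv_cancel₀ hk]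
    ring
  have h2 : Tendsto (fun n : ℕ => (∑ k ∈ Finset.range n, (-1 : ℝ) ^ k) / n) atTop (𝓝 0) := by
    refine squeeze_zero_norm (fun n => ?_) tendsto_one_div_atTop_nhds_zero_nat
    rw [Real.norm_eq_abs, abs_div, Nat.abs_cast]
    refine div_le_div_of_nonneg_right ?_ (by positivity)
    rw [neg_one_geom_sum]
    split_ifs <;> simp
  have h3 := h2.const_add 1
  rw [add_zero] at h3
  refine h3.congr' ?_
  filter_upwards [eventually_ge_atTop 1] with n hn
  have hn' : (n : ℝ) ≠ 0 := by positivity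
  rw [h1, Finset.sum_add_distrib, add_div]
  simp [hn']

/-- Riemann–Lebesgue, read off from Parseval for `f * w` cut off to `(δ, π]` and extended by zero.
-/
lemma tendsto_integral_mul_cos_sin {f w : ℝ → ℝ} (hm : AEMeasurable f) {C : ℝ}
    (hC : ∀ x, |f x| ≤ C) {δ : ℝ} (hδ : 0 < δ) (hδ' : δ ≤ Real.pi)
    (hw : ContinuousOn w (Set.Icc δ Real.pi)) :
    Tendsto (fun n : ℕ => ∫ u in δ..Real.pi, f u * w u * Real.cos (n * u)) atTop (𝓝 0) ∧
    Tendsto (fun n : ℕ => ∫ u in δ..Real.pi, f u * w u * Real.sin (n * u)) atTop (𝓝 0) := by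
  obtain ⟨D, hD⟩ := isCompact_Icc.exists_bound_of_continuousOn hw
  set H : ℝ → ℝ := (Set.Ioc δ Real.pi).indicator fun u => f u * w u with hH
  have hHm : AEMeasurable H := by
    rw [hH, aemeasurable_indicator_iff measurableSet_Ioc]
    exact hm.restrict.mul
      ((hw.mono Set.Ioc_subset_Icc_self).aemeasurable measurableSet_Ioc)
  have hHb : ∀ x, |H x| ≤ C * |D| := fun x => by
    have hC0 : 0 ≤ C := (abs_nonneg _).trans (hC 0)
    by_cases hx : x ∈ Set.Ioc δ Real.pi
    · rw [hH, Set.indicator_of_mem hx, abs_mul]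
      exact mul_le_mul (hC x) ((hD x (Set.Ioc_subset_Icc_self hx)).trans (le_abs_self D))
        (abs_nonneg _) hC0
    · rw [hH, Set.indicator_of_notMem hx, abs_zero]; positivity
  have heq : ∀ v : ℝ → ℝ, ∫ u in (-Real.pi)..Real.pi, H u * v u =
      ∫ u in δ..Real.pi, f u * w u * v u := fun v => by
    rw [intervalIntegral.integral_of_le (by linarith), intervalIntegral.integral_of_le hδ']
    have : (fun u => H u * v u) = (Set.Ioc δ Real.pi).indicator fun u => f u * w u * v u := by
      funext u
      by_cases hu : u ∈ Set.Ioc δ Real.pi <;> simp [hH, hu]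
    rw [this, MeasureTheory.setIntegral_indicator measurableSet_Ioc,
      Set.inter_eq_self_of_subset_right (Set.Ioc_subset_Ioc_left (by linarith))]
  have hs := summable_sq_integral_cos_sin hHm hHb
  simp only [heq] at hs
  exact ⟨tendsto_zero_of_summable_sq hs.1, tendsto_zero_of_summable_sq hs.2⟩

lemma tendsto_integral_mul_jumpKernel_far {f : ℝ → ℝ} (hm : AEMeasurable f) {C : ℝ}
    (hC : ∀ x, |f x| ≤ C) {δ : ℝ} (hδ : 0 < δ) (hδ' : δ ≤ Real.pi) :
    Tendsto (fun n : ℕ => ∫ u in δ..Real.pi, f u * jumpKernel n u) atTop (𝓝 0) := by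
  have hsub : Set.Icc δ Real.pi ⊆ Set.Ioc 0 Real.pi := fun x hx => ⟨hδ.trans_le hx.1, hx.2⟩
  have hw1 := continuousOn_inv_one_sub_cos hsub
  have hw2 := continuousOn_halfCot hsub
  have hw3 : ContinuousOn (fun _ : ℝ => (1 : ℝ) / 2) (Set.Icc δ Real.pi) := continuousOn_const
  have t1 := (tendsto_integral_mul_cos_sin hm hC hδ hδ' hw1).2
  have t2 := (tendsto_integral_mul_cos_sin hm hC hδ hδ' hw2).1
  have t3 := (tendsto_integral_mul_cos_sin hm hC hδ hδ' hw3).2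
  have t := (((tendsto_one_div_atTop_nhds_zero_nat (𝕜 := ℝ)).mul t1).add t3).sub t2
  simp only [mul_zero, add_zero, sub_zero] at t
  refine t.congr' ?_
  filter_upwards [eventually_ge_atTop 1] with n hn
  have hint : ∀ w v : ℝ → ℝ, ContinuousOn w (Set.Icc δ Real.pi) → Continuous v →
      IntervalIntegrable (fun u => f u * w u * v u) MeasureTheory.volume δ Real.pi :=
    fun w v hw hv => ((intervalIntegrable_of_abs_le hm hC _ _).mul_continuousOn
      (by rwa [Set.uIcc_of_le hδ'])).mul_continuousOn hv.continuousOn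
  have i1 := hint _ (fun u => Real.sin (n * u)) hw1 (by fun_prop)
  have i2 := hint _ (fun u => Real.cos (n * u)) hw2 (by fun_prop)
  have i3 := hint _ (fun u => Real.sin (n * u)) hw3 (by fun_prop)
  rw [← intervalIntegral.integral_const_mul, ← intervalIntegral.integral_add (i1.const_mul _) i3,
    ← intervalIntegral.integral_sub ((i1.const_mul _).add i3) i2]
  refine intervalIntegral.integral_congr fun u hu => ?_
  rw [Set.uIcc_of_le hδ'] at hu
  rw [jumpKernel_eq (by omega) (hsub hu).1 (hsub hu).2]
  ring

/-! ### Harmonic variation controls the kernel near zero -/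

lemma two_mul_alternating_sum (F : ℕ → ℝ) (p : ℕ) :
    2 * ∑ i ∈ Finset.range (p + 1), (-1) ^ i * F i =
      F 0 + (-1) ^ p * F p + ∑ i ∈ Finset.range p, (-1) ^ i * (F i - F (i + 1)) := by
  induction p with
  | zero => simp; ring
  | succ p ih =>
    rw [Finset.sum_range_succ, mul_add, ih, Finset.sum_range_succ]
    ring

/-- Pairing neighbours replaces the alternating sum by differences of `φ * α`. The increments of `φ`
meet `α i ≤ H/(i+1)` and are absorbed by `hvar`; the decrements of `α` telescope. -/
lemma abs_alternating_sum_le {φ α : ℕ → ℝ} {p : ℕ} {ω H : ℝ} (hφ : ∀ i ≤ p, |φ i| ≤ ω)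
    (hα0 : ∀ i ≤ p, 0 ≤ α i) (hα : ∀ i < p, α (i + 1) ≤ α i)
    (hαH : ∀ i ≤ p, α i ≤ H / ((i : ℝ) + 1))
    (hvar : ∑ i ∈ Finset.range p, |φ (i + 1) - φ i| / ((i : ℝ) + 1) ≤ ω) :
    |∑ i ∈ Finset.range (p + 1), (-1) ^ i * (φ i * α i)| ≤ 2 * ω * H := by
  have hω : 0 ≤ ω := (abs_nonneg _).trans (hφ 0 (Nat.zero_le _))
  have hα0H : α 0 ≤ H := by simpa using hαH 0 (Nat.zero_le _)
  have hH : 0 ≤ H := (hα0 0 (Nat.zero_le _)).trans hα0H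
  have hb : ∀ i ≤ p, |φ i * α i| ≤ ω * α i := fun i hi => by
    rw [abs_mul, abs_of_nonneg (hα0 i hi)]
    exact mul_le_mul_of_nonneg_right (hφ i hi) (hα0 i hi)
  have hsum : |∑ i ∈ Finset.range p, (-1 : ℝ) ^ i * (φ i * α i - φ (i + 1) * α (i + 1))| ≤
      ω * H + ω * (α 0 - α p) := by
    calc _ ≤ ∑ i ∈ Finset.range p, |(-1 : ℝ) ^ i * (φ i * α i - φ (i + 1) * α (i + 1))| :=
          Finset.abs_sum_le_sum_abs _ _
      _ ≤ ∑ i ∈ Finset.range p,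
          (|φ (i + 1) - φ i| / ((i : ℝ) + 1) * H + ω * (α i - α (i + 1))) := by
          refine Finset.sum_le_sum fun i hi => ?_
          have hi := Finset.mem_range.1 hi
          rw [abs_mul, abs_pow, abs_neg, abs_one, one_pow, one_mul]
          have e : φ i * α i - φ (i + 1) * α (i + 1) =
              -(φ (i + 1) - φ i) * α i + φ (i + 1) * (α i - α (i + 1)) := by ring
          rw [e]
          refine (abs_add_le _ _).trans (add_le_add ?_ ?_)
          · rw [abs_mul, abs_neg, abs_of_nonneg (hα0 i hi.le), div_mul_eq_mul_div, ← mul_div_assoc']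
            exact mul_le_mul_of_nonneg_left (hαH i hi.le) (abs_nonneg _)
          · rw [abs_mul, abs_of_nonneg (sub_nonneg.2 (hα i hi))]
            exact mul_le_mul_of_nonneg_right (hφ _ hi) (sub_nonneg.2 (hα i hi))
      _ ≤ _ := by
          rw [Finset.sum_add_distrib, ← Finset.sum_mul, ← Finset.mul_sum,
            Finset.sum_range_sub']
          exact add_le_add (mul_le_mul_of_nonneg_right hvar hH) le_rfl
  have h2 := two_mul_alternating_sum (fun i => φ i * α i) p
  have h3 : |2 * ∑ i ∈ Finset.range (p + 1), (-1) ^ i * (φ i * α i)| ≤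
      ω * α 0 + ω * α p + (ω * H + ω * (α 0 - α p)) := by
    rw [h2]
    refine (abs_add_le _ _).trans (add_le_add ((abs_add_le _ _).trans (add_le_add (hb 0 (Nat.zero_le _)) ?_)) hsum)
    rw [abs_mul, abs_pow, abs_neg, abs_one, one_pow, one_mul]
    exact hb p le_rfl
  rw [abs_mul, abs_two] at h3
  have := mul_le_mul_of_nonneg_left hα0H hω
  nlinarith [mul_nonneg hω hH]

/-- The main estimate: oscillating integrals against the cotangent are controlled by the harmonic
variation. -/
lemma abs_integral_halfCot_cos_le {f : ℝ → ℝ} (hm : AEMeasurable f) {C : ℝ}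
    (hC : ∀ x, |f x| ≤ C) {δ ω : ℝ} (hδ : δ ≤ Real.pi) (hω : ∀ u ∈ Set.Ioo 0 δ, |f u| ≤ ω)
    (hvar : VariationLE (fun i => (i : ℝ) + 1) δ ω f) {n : ℕ} (hn : n ≠ 0) {q : ℕ}
    (hω0 : 0 ≤ ω) (hq : (q + 1 : ℝ) * (Real.pi / n) < δ) :
    |∫ u in (Real.pi / n)..((q + 1 : ℝ) * (Real.pi / n)), f u * halfCot u * Real.cos (n * u)| ≤
      2 * ω := by
  have hn' : (0 : ℝ) < n := by positivity
  set h : ℝ := Real.pi / n with hh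
  have hpos : 0 < h := by positivity
  rcases Nat.eq_zero_or_pos q with rfl | hq0
  · simp; exact hω0
  obtain ⟨p, rfl⟩ : ∃ p, q = p + 1 := ⟨q - 1, by omega⟩
  set G : ℝ → ℝ := fun u => f u * halfCot u * Real.cos (n * u) with hG
  have hint : ∀ i < p + 1, IntervalIntegrable G MeasureTheory.volume
      (((i + 1 : ℕ) : ℝ) * h) (((i + 1 + 1 : ℕ) : ℝ) * h) := by
    intro i hi
    refine ((intervalIntegrable_of_abs_le hm hC _ _).mul_continuousOn
      (continuousOn_halfCot ?_)).mul_continuousOn (by fun_prop)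
    have hle : ((i + 1 : ℕ) : ℝ) * h ≤ ((i + 1 + 1 : ℕ) : ℝ) * h :=
      mul_le_mul_of_nonneg_right (by push_cast; linarith) hpos.le
    rw [Set.uIcc_of_le hle]
    intro u hu
    refine ⟨lt_of_lt_of_le (by positivity) hu.1, hu.2.trans ?_⟩
    have : ((i + 1 + 1 : ℕ) : ℝ) * h ≤ (((p + 1 : ℕ) : ℝ) + 1) * h := by
      refine mul_le_mul_of_nonneg_right ?_ hpos.le
      exact_mod_cast (by omega : i + 1 + 1 ≤ p + 1 + 1)
    linarith
  -- All pieces are translated to `(0, h)`, so that for each fixed `u` the points `u + (i+1) h` form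
  -- one chain along which `f` is differenced.
  have hsplit : ∫ u in h..(((p + 1 : ℕ) : ℝ) + 1) * h, G u =
      ∑ i ∈ Finset.range (p + 1), ∫ u in (0 : ℝ)..h, G (u + ((i + 1 : ℕ) : ℝ) * h) := by
    have := intervalIntegral.sum_integral_adjacent_intervals
      (a := fun i : ℕ => ((i + 1 : ℕ) : ℝ) * h) hint
    simp only [zero_add, Nat.cast_one, one_mul] at this
    rw [show (((p + 1 : ℕ) : ℝ) + 1) = ((p + 1 + 1 : ℕ) : ℝ) by push_cast; ring, ← this]
    refine Finset.sum_congr rfl fun i _ => ?_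
    rw [intervalIntegral.integral_comp_add_right, zero_add]
    congr 1
    push_cast; ring
  have hint' : ∀ i ∈ Finset.range (p + 1), IntervalIntegrable
      (fun u => G (u + ((i + 1 : ℕ) : ℝ) * h)) MeasureTheory.volume 0 h := by
    intro i hi
    have := (hint i (Finset.mem_range.1 hi)).comp_add_right (((i + 1 : ℕ) : ℝ) * h)
    convert this using 1
    · ring
    · push_cast; ring
  rw [hsplit, ← intervalIntegral.integral_finsetSum hint']
  have hbound : ∀ u ∈ Set.uIoc 0 h, ‖∑ i ∈ Finset.range (p + 1), G (u + ((i + 1 : ℕ) : ℝ) * h)‖ ≤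
      2 * ω * (1 / h) := by
    intro u hu
    rw [Set.uIoc_of_le hpos.le] at hu
    have hlt : ∀ i ≤ p, u + ((i + 1 : ℕ) : ℝ) * h < δ := fun i hi => by
      have h1 : ((i + 1 : ℕ) : ℝ) * h ≤ ((p + 1 : ℕ) : ℝ) * h := by
        refine mul_le_mul_of_nonneg_right ?_ hpos.le
        exact_mod_cast (by omega : i + 1 ≤ p + 1)
      have := hu.2
      rw [add_mul, one_mul] at hq
      linarith
    have hgt : ∀ i : ℕ, ((i + 1 : ℕ) : ℝ) * h < u + ((i + 1 : ℕ) : ℝ) * h := fun i => by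
      linarith [hu.1]
    have hgt0 : ∀ i : ℕ, 0 < ((i + 1 : ℕ) : ℝ) * h := fun i => by positivity
    have hstep : ∀ i : ℕ, u + ((i + 1 + 1 : ℕ) : ℝ) * h = u + ((i + 1 : ℕ) : ℝ) * h + h := fun i => by
      push_cast; ring
    have hfam : IsFamilyIn δ p (fun i => u + ((i + 1 : ℕ) : ℝ) * h)
        (fun i => u + ((i + 1 + 1 : ℕ) : ℝ) * h) := by
      refine ⟨fun i _ => by simp only [hstep]; linarith, fun i _ => (hgt0 i).trans (hgt i),
        fun i hi => hlt (i + 1) hi, fun i _ j _ hij => ?_⟩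
      have key : ∀ i j : ℕ, i < j → Disjoint
          (Set.Ioo (u + ((i + 1 : ℕ) : ℝ) * h) (u + ((i + 1 + 1 : ℕ) : ℝ) * h))
          (Set.Ioo (u + ((j + 1 : ℕ) : ℝ) * h) (u + ((j + 1 + 1 : ℕ) : ℝ) * h)) := by
        intro i j hij
        refine Set.disjoint_left.2 fun z hz hz' => ?_
        have h1 : ((i + 1 + 1 : ℕ) : ℝ) * h ≤ ((j + 1 : ℕ) : ℝ) * h := by
          refine mul_le_mul_of_nonneg_right ?_ hpos.le
          exact_mod_cast (by omega : i + 1 + 1 ≤ j + 1)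
        have := hz.2; have := hz'.1
        linarith
      rcases lt_or_gt_of_ne hij with h' | h'
      · exact key i j h'
      · exact (key j i h').symm
    -- A shift by `h = π/n` reverses the sign of `cos(nu)`.
    have hs : ∑ i ∈ Finset.range (p + 1), G (u + ((i + 1 : ℕ) : ℝ) * h) =
        -Real.cos (n * u) * ∑ i ∈ Finset.range (p + 1), (-1) ^ i *
          (f (u + ((i + 1 : ℕ) : ℝ) * h) * halfCot (u + ((i + 1 : ℕ) : ℝ) * h)) := by
      rw [Finset.mul_sum]
      refine Finset.sum_congr rfl fun i _ => ?_
      have e : (n : ℝ) * (u + ((i + 1 : ℕ) : ℝ) * h) = n * u + ((i + 1 : ℕ) : ℝ) * Real.pi := by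
        rw [hh]; field_simp
      simp only [hG]
      rw [e, Real.cos_add_nat_mul_pi, pow_succ]
      ring
    rw [Real.norm_eq_abs, hs, abs_mul, abs_neg]
    refine (mul_le_of_le_one_left (abs_nonneg _) (Real.abs_cos_le_one _)).trans ?_
    refine abs_alternating_sum_le (φ := fun i => f (u + ((i + 1 : ℕ) : ℝ) * h))
      (α := fun i => halfCot (u + ((i + 1 : ℕ) : ℝ) * h)) ?_ ?_ ?_ ?_ (hvar p _ _ hfam)
    · exact fun i hi => hω _ ⟨(hgt0 i).trans (hgt i), hlt i hi⟩
    · exact fun i hi => halfCot_nonneg ((hgt0 i).trans (hgt i)) ((hlt i hi).le.trans hδ)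
    · exact fun i hi => halfCot_anti ((hgt0 i).trans (hgt i)) (by simp only [hstep]; linarith)
        ((hlt (i + 1) hi).le.trans hδ)
    · intro i hi
      refine (halfCot_le ((hgt0 i).trans (hgt i)) ((hlt i hi).le.trans hδ)).trans ?_
      rw [div_div]
      refine one_div_le_one_div_of_le (by positivity) ?_
      have := hgt i
      push_cast at this ⊢
      linarith
  have := intervalIntegral.norm_integral_le_of_norm_le_const hbound
  rw [Real.norm_eq_abs] at this
  refine this.trans (le_of_eq ?_)
  rw [sub_zero, abs_of_pos hpos]
  field_simp

lemma abs_integral_mul_jumpKernel_le {f : ℝ → ℝ} {a b ω : ℝ} (hab : a ≤ b)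
    (hω : ∀ u ∈ Set.Ioc a b, |f u| ≤ ω) (n : ℕ) :
    |∫ u in a..b, f u * jumpKernel n u| ≤ ω * n * (b - a) := by
  have := intervalIntegral.norm_integral_le_of_norm_le_const (a := a) (b := b)
    (f := fun u => f u * jumpKernel n u) (C := ω * n) fun u hu => by
      rw [Set.uIoc_of_le hab] at hu
      rw [Real.norm_eq_abs, abs_mul]
      exact mul_le_mul (hω u hu) (abs_jumpKernel_le n u) (abs_nonneg _)
        ((abs_nonneg _).trans (hω u hu))
  rwa [abs_of_nonneg (sub_nonneg.2 hab)] at this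

/-- On `[0, h]` and on the leftover `[B, η]`, both of length at most `h = π/n`, the bound `|K_n| ≤
n` for the kernel gives `πω` each. The middle part costs `π/4 + π/2 + 2` times `ω`, and `11π/4 + 2 <
12`. -/
lemma abs_integral_mul_jumpKernel_near_le {f : ℝ → ℝ} (hm : AEMeasurable f) {C : ℝ}
    (hC : ∀ x, |f x| ≤ C) {δ η ω : ℝ} (hδ : δ ≤ Real.pi) (hω : ∀ u ∈ Set.Ioo 0 δ, |f u| ≤ ω)
    (hvar : VariationLE (fun i => (i : ℝ) + 1) δ ω f) (hω0 : 0 ≤ ω) (hη : 0 < η) (hηδ : η < δ)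
    {n : ℕ} (hn : n ≠ 0) (hnη : Real.pi / n ≤ η) :
    |∫ u in (0 : ℝ)..η, f u * jumpKernel n u| ≤ 12 * ω := by
  have hn' : (0 : ℝ) < n := by positivity
  have hpi := Real.pi_pos
  set h : ℝ := Real.pi / n with hh
  have hpos : 0 < h := by positivity
  have hnh : n * h = Real.pi := by rw [hh]; field_simp
  -- Here `q + 1` is the integer part of `η / h`.
  obtain ⟨q, hq1, hq2⟩ : ∃ q : ℕ, ((q : ℝ) + 1) * h ≤ η ∧ η - ((q : ℝ) + 1) * h ≤ h := by
    have h1 : 1 ≤ ⌊η / h⌋₊ := by rw [Nat.one_le_floor_iff, le_div_iff₀ hpos]; linarith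
    have h2 := Nat.floor_le (show 0 ≤ η / h by positivity)
    have h3 := Nat.lt_floor_add_one (η / h)
    rw [le_div_iff₀ hpos] at h2
    rw [div_lt_iff₀ hpos] at h3
    refine ⟨⌊η / h⌋₊ - 1, ?_, ?_⟩ <;> push_cast [h1]
    · linarith
    · linarith
  set B : ℝ := ((q : ℝ) + 1) * h with hB
  have hhB : h ≤ B := by rw [hB]; nlinarith [hpos, (Nat.cast_nonneg q : (0 : ℝ) ≤ q)]
  have hint : ∀ a b : ℝ, IntervalIntegrable (fun u => f u * jumpKernel n u)
      MeasureTheory.volume a b := fun a b =>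
    (intervalIntegrable_of_abs_le hm hC _ _).mul_continuousOn (continuous_jumpKernel n).continuousOn
  have p1 : |∫ u in (0 : ℝ)..h, f u * jumpKernel n u| ≤ ω * Real.pi := by
    refine (abs_integral_mul_jumpKernel_le hpos.le (ω := ω) (fun u hu => hω u ⟨hu.1, ?_⟩) n).trans ?_
    · linarith [hu.2]
    · rw [sub_zero, mul_assoc, hnh]
  have p3 : |∫ u in B..η, f u * jumpKernel n u| ≤ ω * Real.pi := by
    refine (abs_integral_mul_jumpKernel_le hq1 (ω := ω) (fun u hu => hω u ⟨?_, ?_⟩) n).trans ?_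
    · linarith [hu.1]
    · linarith [hu.2]
    · rw [mul_assoc, ← hnh]
      exact mul_le_mul_of_nonneg_left (mul_le_mul_of_nonneg_left hq2 hn'.le) hω0
  have hsub : Set.Icc h B ⊆ Set.Ioc 0 Real.pi := fun u hu =>
    ⟨hpos.trans_le hu.1, by linarith [hu.2]⟩
  have hωB : ∀ u ∈ Set.Icc h B, |f u| ≤ ω := fun u hu => hω u ⟨(hsub hu).1, by linarith [hu.2]⟩
  have hint' : ∀ w v : ℝ → ℝ, ContinuousOn w (Set.Icc h B) → Continuous v →
      IntervalIntegrable (fun u => f u * w u * v u) MeasureTheory.volume h B :=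
    fun w v hw hv => ((intervalIntegrable_of_abs_le hm hC _ _).mul_continuousOn
      (by rwa [Set.uIcc_of_le hhB])).mul_continuousOn hv.continuousOn
  have i1 := hint' _ (fun u => Real.sin (n * u)) (continuousOn_inv_one_sub_cos hsub) (by fun_prop)
  have i2 := hint' _ (fun u => Real.cos (n * u)) (continuousOn_halfCot hsub) (by fun_prop)
  have i3 := hint' (fun _ => 1 / 2) (fun u => Real.sin (n * u)) continuousOn_const (by fun_prop)
  have heq : ∫ u in h..B, f u * jumpKernel n u =
      1 / n * (∫ u in h..B, f u * (1 / (2 * (1 - Real.cos u))) * Real.sin (n * u)) +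
      (∫ u in h..B, f u * (1 / 2) * Real.sin (n * u)) -
      ∫ u in h..B, f u * halfCot u * Real.cos (n * u) := by
    rw [← intervalIntegral.integral_const_mul, ← intervalIntegral.integral_add (i1.const_mul _) i3,
      ← intervalIntegral.integral_sub ((i1.const_mul _).add i3) i2]
    refine intervalIntegral.integral_congr fun u hu => ?_
    rw [Set.uIcc_of_le hhB] at hu
    rw [jumpKernel_eq hn (hsub hu).1 (hsub hu).2]
    ring
  have q1 : |∫ u in h..B, f u * (1 / (2 * (1 - Real.cos u))) * Real.sin (n * u)| ≤
      ω * (Real.pi ^ 2 / 4) * (1 / h) := by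
    have hne : ∀ u ∈ Set.uIcc h B, u ≠ 0 := fun u hu => by
      rw [Set.uIcc_of_le hhB] at hu
      exact (hsub hu).1.ne'
    have hcont : ContinuousOn (fun u : ℝ => ω * (Real.pi ^ 2 / 4) * (1 / u ^ 2)) (Set.uIcc h B) :=
      continuousOn_const.mul (continuousOn_const.div (by fun_prop) fun u hu => pow_ne_zero 2 (hne u hu))
    have hb := intervalIntegral.norm_integral_le_of_norm_le (μ := MeasureTheory.volume)
      (f := fun u => f u * (1 / (2 * (1 - Real.cos u))) * Real.sin (n * u))
      (g := fun u : ℝ => ω * (Real.pi ^ 2 / 4) * (1 / u ^ 2)) hhB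
      (Eventually.of_forall fun u hu => by
        have hu := Set.Ioc_subset_Icc_self hu
        have hc := one_sub_cos_pos (hsub hu).1 (hsub hu).2
        rw [Real.norm_eq_abs, abs_mul, abs_mul, mul_assoc ω]
        refine (mul_le_of_le_one_right (by positivity) (Real.abs_sin_le_one _)).trans ?_
        rw [abs_of_pos (show 0 < 1 / (2 * (1 - Real.cos u)) by positivity)]
        exact mul_le_mul (hωB u hu) (inv_one_sub_cos_le (hsub hu).1 (hsub hu).2) (by positivity) hω0)
      hcont.intervalIntegrable
    have hftc : ∫ u in h..B, 1 / u ^ 2 = -B⁻¹ - -h⁻¹ := by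
      refine intervalIntegral.integral_eq_sub_of_hasDerivAt (f := fun u : ℝ => -u⁻¹)
        (fun u hu => ?_) ?_
      · exact (hasDerivAt_inv (hne u hu)).neg.congr_deriv (by simp)
      · exact ContinuousOn.intervalIntegrable (continuousOn_const.div (by fun_prop)
          fun u hu => pow_ne_zero 2 (hne u hu))
    rw [intervalIntegral.integral_const_mul, hftc, Real.norm_eq_abs] at hb
    refine hb.trans (mul_le_mul_of_nonneg_left ?_ (by positivity))
    have : 0 < B⁻¹ := inv_pos.2 (hpos.trans_le hhB)
    rw [one_div]; linarith
  have q3 : |∫ u in h..B, f u * (1 / 2) * Real.sin (n * u)| ≤ ω * (1 / 2) * (B - h) := by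
    have := intervalIntegral.norm_integral_le_of_norm_le_const (a := h) (b := B)
      (f := fun u => f u * (1 / 2) * Real.sin (n * u)) (C := ω * (1 / 2)) fun u hu => by
        rw [Set.uIoc_of_le hhB] at hu
        rw [Real.norm_eq_abs, abs_mul]
        refine (mul_le_of_le_one_right (abs_nonneg _) (Real.abs_sin_le_one _)).trans ?_
        rw [abs_mul, abs_of_pos (by norm_num : (0 : ℝ) < 1 / 2)]
        exact mul_le_mul_of_nonneg_right (hωB u (Set.Ioc_subset_Icc_self hu)) (by norm_num)
    rwa [abs_of_nonneg (sub_nonneg.2 hhB)] at this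
  have q2 := abs_integral_halfCot_cos_le hm hC hδ hω hvar hn (q := q) hω0 (by
    rw [← hh, ← hB]; linarith)
  rw [← hh, ← hB] at q2
  have p2 : |∫ u in h..B, f u * jumpKernel n u| ≤
      ω * (Real.pi / 4) + ω * (1 / 2) * Real.pi + 2 * ω := by
    rw [heq]
    refine (abs_sub _ _).trans (add_le_add ((abs_add_le _ _).trans (add_le_add ?_ ?_)) q2)
    · rw [abs_mul, abs_of_pos (by positivity)]
      refine (mul_le_mul_of_nonneg_left q1 (by positivity)).trans (le_of_eq ?_)
      rw [hh]; field_simp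
    · refine q3.trans (mul_le_mul_of_nonneg_left (by linarith) (by positivity))
  rw [← intervalIntegral.integral_add_adjacent_intervals (hint 0 h) (hint h η),
    ← intervalIntegral.integral_add_adjacent_intervals (hint h B) (hint B η)]
  have h4 := abs_add_le (∫ u in (0 : ℝ)..h, f u * jumpKernel n u)
    ((∫ u in h..B, f u * jumpKernel n u) + ∫ u in B..η, f u * jumpKernel n u)
  have h5 := abs_add_le (∫ u in h..B, f u * jumpKernel n u) (∫ u in B..η, f u * jumpKernel n u)
  have hpi4 := mul_le_mul_of_nonneg_left Real.pi_le_four hω0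
  have hpi3 := mul_le_mul_of_nonneg_left Real.pi_lt_d2.le hω0
  nlinarith

/-- The jump kernel reproduces right limits of functions of bounded harmonic variation. -/
lemma tendsto_integral_mul_jumpKernel {f : ℝ → ℝ} (hm : AEMeasurable f) {C : ℝ}
    (hC : ∀ x, |f x| ≤ C) {δ V L : ℝ} (hδ : 0 < δ)
    (hvar : VariationLE (fun i => (i : ℝ) + 1) δ V f) (hL : Tendsto f (𝓝[>] 0) (𝓝 L)) :
    Tendsto (fun n : ℕ => ∫ u in (0 : ℝ)..Real.pi, f u * jumpKernel n u) atTop (𝓝 L) := by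
  have key : ∀ (f : ℝ → ℝ) (C : ℝ), AEMeasurable f → (∀ x, |f x| ≤ C) →
      VariationLE (fun i => (i : ℝ) + 1) δ V f → Tendsto f (𝓝[>] 0) (𝓝 0) →
      Tendsto (fun n : ℕ => ∫ u in (0 : ℝ)..Real.pi, f u * jumpKernel n u) atTop (𝓝 0) := by
    intro f C hm hC hvar hL
    rw [Metric.tendsto_atTop']
    intro ε hε
    -- The near part then costs at most `12 ω = ε/2`.
    set ω := ε / 24 with hω
    have hω0 : 0 < ω := by positivity
    obtain ⟨δ₁, hδ₁, hv⟩ := hvar.exists_small isWatermanSeq_nat_add_one hδ hL hω0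
    obtain ⟨δ₂, hδ₂, hs⟩ := mem_nhdsGT_iff_exists_Ioo_subset.1 (Metric.tendsto_nhds.1 hL ω hω0)
    set δ₃ := min Real.pi (min δ₁ δ₂) with hδ₃
    have hδ₃0 : 0 < δ₃ := lt_min Real.pi_pos (lt_min hδ₁ hδ₂)
    have hfar := tendsto_integral_mul_jumpKernel_far hm hC (half_pos hδ₃0)
      ((half_le_self hδ₃0.le).trans (min_le_left _ _))
    have hsmall : Tendsto (fun n : ℕ => Real.pi / n) atTop (𝓝 0) :=
      tendsto_const_div_atTop_nhds_zero_nat _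
    have hev := ((hsmall.eventually_le_const (half_pos hδ₃0)).and (eventually_ge_atTop 1)).and
      (Metric.tendsto_nhds.1 hfar (ε / 2) (half_pos hε))
    obtain ⟨N, hN⟩ := eventually_atTop.1 hev
    refine ⟨N, fun n hn => ?_⟩
    obtain ⟨⟨h1, h2⟩, h3⟩ := hN n hn.le
    have hint : ∀ a b : ℝ, IntervalIntegrable (fun u => f u * jumpKernel n u)
        MeasureTheory.volume a b := fun a b =>
      (intervalIntegrable_of_abs_le hm hC _ _).mul_continuousOn
        (continuous_jumpKernel n).continuousOn
    have hnear := abs_integral_mul_jumpKernel_near_le hm hC (δ := δ₃) (η := δ₃ / 2) (ω := ω)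
      (min_le_left _ _) (fun u hu => by
        have : dist (f u) 0 < ω := hs ⟨hu.1, hu.2.trans_le ((min_le_right _ _).trans (min_le_right _ _))⟩
        rw [Real.dist_0_eq_abs] at this
        exact this.le)
      (fun N a b h => hv N a b (h.mono ((min_le_right _ _).trans (min_le_left _ _)))) hω0.le
      (half_pos hδ₃0) (half_lt_self hδ₃0) (by omega) h1
    rw [Real.dist_0_eq_abs] at h3 ⊢
    rw [← intervalIntegral.integral_add_adjacent_intervals (hint 0 (δ₃ / 2)) (hint _ Real.pi)]
    refine (abs_add_le _ _).trans_lt ?_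
    linarith
  have h0 := key (fun u => f u - L) (C + |L|) (hm.sub_const L)
    (fun x => (abs_sub _ _).trans (add_le_add (hC x) le_rfl))
    (fun N a b h => by simpa using hvar N a b h) (by simpa using hL.sub_const L)
  have h1 := h0.add (tendsto_integral_jumpKernel.const_mul L)
  rw [zero_add, mul_one] at h1
  refine h1.congr fun n => ?_
  rw [← intervalIntegral.integral_const_mul, ← intervalIntegral.integral_add]
  · refine intervalIntegral.integral_congr fun u _ => ?_
    ring
  · exact ((intervalIntegrable_of_abs_le hm hC _ _).sub intervalIntegrable_const).mul_continuousOn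
      (continuous_jumpKernel n).continuousOn
  · exact ((continuous_jumpKernel n).intervalIntegrable _ _).const_mul _

lemma jumpSum_div_eq {g : ℝ → ℝ} (hg : IsBoundedPeriodic g) (x : ℝ) (n : ℕ) :
    jumpSum g x n / n = 1 / Real.pi * ∫ u in (-Real.pi)..Real.pi, g (x + u) * jumpKernel n u := by
  have hgx := hg.comp_add x
  obtain ⟨C, hC⟩ := hgx.bounded
  have hi : ∀ k : ℕ, IntervalIntegrable (fun u => g (x + u) * Real.sin (k * u))
      MeasureTheory.volume (-Real.pi) Real.pi := fun k =>
    intervalIntegrable_mul_of_abs_le hgx.aemeasurable hC (by fun_prop)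
      (fun _ => Real.abs_sin_le_one _) _ _
  have e : ∫ u in (-Real.pi)..Real.pi, g (x + u) * jumpKernel n u =
      (∑ k ∈ Finset.range n, ((k + 1 : ℕ) : ℝ) *
        ∫ u in (-Real.pi)..Real.pi, g (x + u) * Real.sin ((k + 1 : ℕ) * u)) / n := by
    simp only [← intervalIntegral.integral_const_mul]
    rw [← intervalIntegral.integral_finsetSum fun k _ => (hi (k + 1)).const_mul _,
      ← intervalIntegral.integral_div]
    refine intervalIntegral.integral_congr fun u _ => ?_
    simp only [jumpKernel]
    rw [← mul_div_assoc, Finset.mul_sum]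
    congr 1
    exact Finset.sum_congr rfl fun k _ => by ring
  rw [e, jumpSum, ← mul_div_assoc, Finset.mul_sum]
  congr 1
  exact Finset.sum_congr rfl fun k _ => by rw [jumpCoeff]; ring

/-- Since the kernel is odd, the integral over `[-π, 0]` is minus that of `g (x - u)` over `[0, π]`;
the two halves yield `gp` and `-gm`. -/
lemma HBV.tendsto_jumpSum {g : ℝ → ℝ} (hg : g ∈ HBV) {x gp gm : ℝ}
    (hp : Tendsto g (𝓝[>] x) (𝓝 gp)) (hq : Tendsto g (𝓝[<] x) (𝓝 gm)) :
    Tendsto (fun n : ℕ => jumpSum g x n / n) atTop (𝓝 ((gp - gm) / Real.pi)) := by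
  have hb := LambdaBV.isBoundedPeriodic isWatermanSeq_nat_add_one hg
  obtain ⟨C, hC⟩ := hb.bounded
  have hm := (hb.comp_add x).aemeasurable
  have hm' : AEMeasurable fun u => g (x - u) := by
    have := hm.comp_quasiMeasurePreserving
      (MeasureTheory.Measure.measurePreserving_neg MeasureTheory.volume).quasiMeasurePreserving
    simpa only [Function.comp_def, ← sub_eq_add_neg] using this
  obtain ⟨δ, hδ, V, hV⟩ := LambdaBV.variationLE_right hg x
  obtain ⟨δ', hδ', V', hV'⟩ := LambdaBV.variationLE_left hg x
  have t1 := tendsto_integral_mul_jumpKernel hm (fun u => hC _) hδ hV (tendsto_nhdsGT_iff_add.2 hp)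
  have t2 := tendsto_integral_mul_jumpKernel hm' (fun u => hC _) hδ' hV'
    (tendsto_nhdsLT_iff_sub.2 hq)
  have t := (t1.sub t2).const_mul (1 / Real.pi)
  rw [one_div_mul_eq_div] at t
  refine t.congr fun n => ?_
  rw [jumpSum_div_eq hb]
  have hint : ∀ a b : ℝ, IntervalIntegrable (fun u => g (x + u) * jumpKernel n u)
      MeasureTheory.volume a b := fun a b =>
    (intervalIntegrable_of_abs_le hm (fun u => hC _) _ _).mul_continuousOn
      (continuous_jumpKernel n).continuousOn
  rw [← intervalIntegral.integral_add_adjacent_intervals (hint (-Real.pi) 0) (hint 0 Real.pi)]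
  have e := intervalIntegral.integral_comp_neg (a := 0) (b := Real.pi)
    fun u => g (x + u) * jumpKernel n u
  rw [neg_zero] at e
  rw [← e]
  simp only [jumpKernel_neg, mul_neg, intervalIntegral.integral_neg, ← sub_eq_add_neg]
  ring

/-! ### Comparison of `ΛBV` with `HBV` -/

lemma sum_mul_nonneg_of_partial_sums {Y u : ℕ → ℝ} (hY : Antitone Y) (hY0 : ∀ i, 0 ≤ Y i)
    (hu : ∀ n, 0 ≤ ∑ i ∈ Finset.range n, u i) (n : ℕ) :
    0 ≤ ∑ i ∈ Finset.range n, Y i * u i := by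
  have key : ∀ n, Y n * ∑ i ∈ Finset.range (n + 1), u i ≤
      ∑ i ∈ Finset.range (n + 1), Y i * u i := by
    intro n
    induction n with
    | zero => simp
    | succ n ih =>
      rw [Finset.sum_range_succ, Finset.sum_range_succ _ (n + 1), mul_add]
      have := mul_le_mul_of_nonneg_right (hY n.le_succ) (hu (n + 1))
      exact add_le_add (this.trans ih) le_rfl
  cases n with
  | zero => simp
  | succ n => exact (mul_nonneg (hY0 n) (hu (n + 1))).trans (key n)

/-- Intervals may be listed in any order. By rearrangement the harmonic sum is largest when the
oscillations decrease, and for decreasing oscillations Abel summation needs only the comparison of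
partial sums of weights. -/
lemma lambdaBV_subset_HBV {lam : ℕ → ℝ} {K : ℝ}
    (hK : ∀ n, ∑ i ∈ Finset.range n, 1 / ((i : ℝ) + 1) ≤ K * ∑ i ∈ Finset.range n, 1 / lam i)
    (hK0 : 0 ≤ K) : LambdaBV lam ⊆ HBV := by
  intro f hf
  obtain ⟨V, hV⟩ := LambdaBV.exists_bound hf
  refine mem_lambdaBV_of_bound hf.1 (V := K * V) fun N a b hab => ?_
  set X : Fin N → ℝ := fun i => |f (b i) - f (a i)| with hX
  set σ := Tuple.sort fun i => -X i with hσ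
  have hanti : Antitone fun i => X (σ i) := fun i j hij => by
    have := Tuple.monotone_sort (fun i => -X i) hij
    simpa [hσ] using this
  have hw : Antitone fun i : Fin N => 1 / ((i : ℝ) + 1) := fun i j hij => by
    have : (i : ℝ) ≤ j := by exact_mod_cast hij
    exact one_div_le_one_div_of_le (by positivity) (by linarith)
  have h1 : ∑ i, X i / ((i : ℝ) + 1) ≤ ∑ i, X (σ i) * (1 / ((i : ℝ) + 1)) := by
    have := (hanti.monovary hw).sum_comp_perm_mul_le_sum_mul (σ := σ.symm)
    simp only [Equiv.apply_symm_apply] at this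
    simpa only [div_eq_mul_one_div (X _)] using this
  set Y : ℕ → ℝ := fun i => if h : i < N then X (σ ⟨i, h⟩) else 0 with hY
  have hX0 : ∀ i, 0 ≤ X i := fun i => abs_nonneg _
  have hYa : Antitone Y := fun i j hij => by
    simp only [hY]
    by_cases hj : j < N
    · rw [dif_pos hj, dif_pos (hij.trans_lt hj)]
      exact hanti (by simpa using hij)
    · rw [dif_neg hj]
      split_ifs
      · exact hX0 _
      · exact le_rfl
  have hY0 : ∀ i, 0 ≤ Y i := fun i => by
    simp only [hY]
    split_ifs
    · exact hX0 _
    · exact le_rfl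
  have h2 := sum_mul_nonneg_of_partial_sums hYa hY0
    (u := fun i => K * (1 / lam i) - 1 / ((i : ℝ) + 1)) (fun n => by
      rw [Finset.sum_sub_distrib, ← Finset.mul_sum]
      linarith [hK n]) N
  -- Extending the sorted oscillations by zero keeps them decreasing on all of `ℕ`, as Abel
  -- summation requires.
  have h3 : ∀ w : ℕ → ℝ, ∑ i : Fin N, X (σ i) * w i = ∑ i ∈ Finset.range N, Y i * w i := fun w => by
    rw [← Fin.sum_univ_eq_sum_range (fun i => Y i * w i) N]
    refine Finset.sum_congr rfl fun i _ => ?_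
    simp [hY]
  have h4 := hV N (a ∘ σ) (b ∘ σ) ⟨fun i => hab.lt _, fun i => hab.left_mem _,
    fun i => hab.right_mem _, fun i j hij => hab.disjoint _ _ (σ.injective.ne hij)⟩
  have h5 : ∑ i : Fin N, X (σ i) * (1 / lam i) ≤ V := by
    simpa only [hX, Function.comp_apply, mul_one_div] using h4
  calc _ ≤ ∑ i : Fin N, X (σ i) * (1 / ((i : ℝ) + 1)) := h1
    _ = ∑ i ∈ Finset.range N, Y i * (1 / ((i : ℝ) + 1)) := h3 fun i => 1 / ((i : ℝ) + 1)
    _ ≤ K * ∑ i ∈ Finset.range N, Y i * (1 / lam i) := by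
        rw [Finset.mul_sum, ← sub_nonneg, ← Finset.sum_sub_distrib]
        refine h2.trans (le_of_eq (Finset.sum_congr rfl fun i _ => by ring))
    _ = K * ∑ i : Fin N, X (σ i) * (1 / lam i) := by rw [h3 fun i => 1 / lam i]
    _ ≤ K * V := mul_le_mul_of_nonneg_left h5 hK0

/-! ### Oscillating sawtooths -/

/-- The `2π`-periodic function equal to `(u - π) cos (N u)` on `[0, 2π)`. -/
noncomputable def oscSaw (N : ℕ) (u : ℝ) : ℝ :=
  Real.pi * (2 * Int.fract (u / (2 * Real.pi)) - 1) * Real.cos (N * u)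

lemma oscSaw_periodic (N : ℕ) : Function.Periodic (oscSaw N) (2 * Real.pi) := fun u => by
  have h : (u + 2 * Real.pi) / (2 * Real.pi) = u / (2 * Real.pi) + 1 := by
    have := Real.pi_ne_zero
    field_simp
  rw [oscSaw, h, Int.fract_add_one, mul_add, Real.cos_add_nat_mul_two_pi, oscSaw]

lemma measurable_oscSaw (N : ℕ) : Measurable (oscSaw N) := by
  unfold oscSaw; fun_prop

lemma abs_oscSaw_le (N : ℕ) (u : ℝ) : |oscSaw N u| ≤ Real.pi := by
  rw [oscSaw, abs_mul]
  refine (mul_le_of_le_one_right (abs_nonneg _) (Real.abs_cos_le_one _)).trans ?_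
  rw [abs_mul, abs_of_pos Real.pi_pos]
  refine mul_le_of_le_one_right Real.pi_pos.le ?_
  have := Int.fract_nonneg (u / (2 * Real.pi))
  have := Int.fract_lt_one (u / (2 * Real.pi))
  rw [abs_le]; constructor <;> linarith

lemma oscSaw_eq (N : ℕ) {u : ℝ} (hu : u ∈ Set.Ico 0 (2 * Real.pi)) :
    oscSaw N u = (u - Real.pi) * Real.cos (N * u) := by
  have hpi := Real.pi_pos
  have : Int.fract (u / (2 * Real.pi)) = u / (2 * Real.pi) :=
    Int.fract_eq_self.2 ⟨div_nonneg hu.1 (by positivity), (div_lt_one (by positivity)).2 hu.2⟩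
  rw [oscSaw, this]
  field_simp

lemma abs_oscSaw_sub_le {N : ℕ} {x y : ℝ} (hx : x ∈ Set.Ico 0 (2 * Real.pi))
    (hy : y ∈ Set.Ico 0 (2 * Real.pi)) :
    |oscSaw N y - oscSaw N x| ≤ (1 + Real.pi * N) * |y - x| := by
  rw [oscSaw_eq N hx, oscSaw_eq N hy]
  have e : (y - Real.pi) * Real.cos (N * y) - (x - Real.pi) * Real.cos (N * x) =
      (y - x) * Real.cos (N * y) + (x - Real.pi) * (Real.cos (N * y) - Real.cos (N * x)) := by ring
  rw [e, add_mul, one_mul]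
  refine (abs_add_le _ _).trans (add_le_add ?_ ?_)
  · rw [abs_mul]
    exact mul_le_of_le_one_right (abs_nonneg _) (Real.abs_cos_le_one _)
  · rw [abs_mul, mul_assoc]
    have h1 : |x - Real.pi| ≤ Real.pi := by
      rw [abs_le]; constructor <;> linarith [hx.1, hx.2]
    have h2 : |Real.cos (N * y) - Real.cos (N * x)| ≤ N * |y - x| := by
      have := Real.abs_cos_sub_cos_le (N * y) (N * x)
      rwa [← mul_sub, abs_mul, Nat.abs_cast] at this
    exact mul_le_mul h1 h2 (abs_nonneg _) Real.pi_pos.le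

lemma IsNonoverlapping.sum_length_le {N : ℕ} {a b : Fin N → ℝ} (h : IsNonoverlapping a b) :
    ∑ i, (b i - a i) ≤ 2 * Real.pi := by
  have h1 : MeasureTheory.volume (⋃ i, Set.Ioo (a i) (b i)) =
      ∑ i, ENNReal.ofReal (b i - a i) := by
    rw [MeasureTheory.measure_iUnion (fun i j hij => h.disjoint i j hij)
      fun _ => measurableSet_Ioo, tsum_fintype]
    simp only [Real.volume_Ioo]
  have h2 : (⋃ i, Set.Ioo (a i) (b i)) ⊆ Set.Icc 0 (2 * Real.pi) :=
    Set.iUnion_subset fun i x hx => ⟨(h.left_mem i).trans hx.1.le, hx.2.le.trans (h.right_mem i)⟩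
  have h3 := MeasureTheory.measure_mono (μ := MeasureTheory.volume) h2
  rw [h1, Real.volume_Icc, sub_zero, ← ENNReal.ofReal_sum_of_nonneg
    fun i _ => sub_nonneg.2 (h.lt i).le] at h3
  exact (ENNReal.ofReal_le_ofReal_iff (by positivity)).1 h3

/-- Two nonoverlapping nondegenerate intervals cannot share a right endpoint. This charges the
sawtooth's jump at `2π` only once. -/
lemma IsNonoverlapping.sum_ite_right_le {N : ℕ} {a b : Fin N → ℝ} (h : IsNonoverlapping a b)
    {c : ℝ} (hc : 0 ≤ c) (x : ℝ) : ∑ i, (if b i = x then c else 0) ≤ c := by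
  rw [← Finset.sum_filter, Finset.sum_const, nsmul_eq_mul]
  refine mul_le_of_le_one_left hc ?_
  have : (Finset.univ.filter fun i => b i = x).card ≤ 1 := by
    refine Finset.card_le_one.2 fun i hi j hj => ?_
    by_contra hij
    have hi := (Finset.mem_filter.1 hi).2
    have hj := (Finset.mem_filter.1 hj).2
    have h1 := h.lt i
    have h2 := h.lt j
    obtain ⟨z, hz, hz'⟩ := exists_between (max_lt h1 (by rwa [hi, ← hj] : a j < b i))
    have hzi : z ∈ Set.Ioo (a i) (b i) := ⟨(le_max_left _ _).trans_lt hz, hz'⟩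
    have hzj : z ∈ Set.Ioo (a j) (b j) := ⟨(le_max_right _ _).trans_lt hz, by rwa [hj, ← hi]⟩
    exact Set.disjoint_left.1 (h.disjoint i j hij) hzi hzj
  exact_mod_cast this

lemma sum_abs_oscSaw_sub_le {N : ℕ} (hN : N ≠ 0) {M : ℕ} {a b : Fin M → ℝ}
    (h : IsNonoverlapping a b) : ∑ i, |oscSaw N (b i) - oscSaw N (a i)| ≤
      (4 * Real.pi + 2 * Real.pi ^ 2) * N := by
  have hN1 : (1 : ℝ) ≤ N := by exact_mod_cast Nat.one_le_iff_ne_zero.2 hN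
  have hpi := Real.pi_pos
  have h1 : ∀ i, |oscSaw N (b i) - oscSaw N (a i)| ≤
      (1 + Real.pi * N) * (b i - a i) + if b i = 2 * Real.pi then 2 * Real.pi else 0 := fun i => by
    have h0 := h.lt i
    have ha : a i ∈ Set.Ico 0 (2 * Real.pi) := ⟨h.left_mem i, h0.trans_le (h.right_mem i)⟩
    split_ifs with hb
    · have := abs_sub (oscSaw N (b i)) (oscSaw N (a i))
      have := abs_oscSaw_le N (b i)
      have := abs_oscSaw_le N (a i)
      have : 0 ≤ (1 + Real.pi * N) * (b i - a i) := mul_nonneg (by positivity) (by linarith)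
      linarith
    · have := abs_oscSaw_sub_le (N := N) ha
        ⟨(h.left_mem i).trans h0.le, lt_of_le_of_ne (h.right_mem i) hb⟩
      rwa [abs_of_pos (sub_pos.2 h0), ← add_zero ((1 + Real.pi * N) * (b i - a i))] at this
  refine (Finset.sum_le_sum fun i _ => h1 i).trans ?_
  rw [Finset.sum_add_distrib, ← Finset.mul_sum]
  have h2 := mul_le_mul_of_nonneg_left h.sum_length_le (show 0 ≤ 1 + Real.pi * N by positivity)
  have h3 := h.sum_ite_right_le (c := 2 * Real.pi) (by positivity) (2 * Real.pi)
  nlinarith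

/-- The first `N` intervals oscillate by at most `2π` each. The others have weight at most `1 / lam
(N - 1)` against a total variation `O(N)`, and `N / lam (N - 1)` is at most the sum of the first `N`
weights by monotonicity. -/
lemma sum_abs_oscSaw_sub_div_le {lam : ℕ → ℝ} (hl : IsWatermanSeq lam) {N : ℕ} (hN : N ≠ 0)
    {M : ℕ} {a b : Fin M → ℝ} (h : IsNonoverlapping a b) :
    ∑ i : Fin M, |oscSaw N (b i) - oscSaw N (a i)| / lam i ≤
      (6 * Real.pi + 2 * Real.pi ^ 2) * ∑ i ∈ Finset.range N, 1 / lam i := by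
  have hpi := Real.pi_pos
  set l := lam (N - 1) with hl'
  have hl0 : 0 < l := hl.pos _
  have h1 : ∀ i : Fin M, |oscSaw N (b i) - oscSaw N (a i)| / lam i ≤
      (if (i : ℕ) < N then 2 * Real.pi * (1 / lam i) else 0) +
        |oscSaw N (b i) - oscSaw N (a i)| * (1 / l) := fun i => by
    have hi := hl.pos i
    split_ifs with hiN
    · have h2 : |oscSaw N (b i) - oscSaw N (a i)| ≤ 2 * Real.pi := by
        have := abs_sub (oscSaw N (b i)) (oscSaw N (a i))
        have := abs_oscSaw_le N (b i)
        have := abs_oscSaw_le N (a i)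
        linarith
      rw [div_eq_mul_one_div]
      have := mul_le_mul_of_nonneg_right h2 (one_div_pos.2 hi).le
      have : 0 ≤ |oscSaw N (b i) - oscSaw N (a i)| * (1 / l) := by positivity
      linarith
    · rw [zero_add, div_eq_mul_one_div]
      exact mul_le_mul_of_nonneg_left (one_div_le_one_div_of_le hl0 (hl.mono (by omega)))
        (abs_nonneg _)
  refine (Finset.sum_le_sum fun i _ => h1 i).trans ?_
  rw [Finset.sum_add_distrib, ← Finset.sum_mul]
  have h2 : ∑ i : Fin M, (if (i : ℕ) < N then 2 * Real.pi * (1 / lam i) else 0) ≤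
      2 * Real.pi * ∑ i ∈ Finset.range N, 1 / lam i := by
    rw [Fin.sum_univ_eq_sum_range (fun i => if i < N then 2 * Real.pi * (1 / lam i) else 0) M,
      ← Finset.sum_filter, Finset.mul_sum]
    refine Finset.sum_le_sum_of_subset_of_nonneg (fun i hi => ?_) fun i _ _ => ?_
    · simpa using (Finset.mem_filter.1 hi).2
    · have := hl.pos i
      positivity
  have h3 : (N : ℝ) * (1 / l) ≤ ∑ i ∈ Finset.range N, 1 / lam i := by
    have : ∑ _i ∈ Finset.range N, 1 / l ≤ ∑ i ∈ Finset.range N, 1 / lam i :=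
      Finset.sum_le_sum fun i hi => one_div_le_one_div_of_le (hl.pos i)
        (hl.mono (by have := Finset.mem_range.1 hi; omega))
    simpa using this
  have h4 := mul_le_mul_of_nonneg_right (sum_abs_oscSaw_sub_le hN h) (one_div_pos.2 hl0).le
  have h5 := mul_le_mul_of_nonneg_left h3 (show 0 ≤ 4 * Real.pi + 2 * Real.pi ^ 2 by positivity)
  linarith

/-- For `m = 0` both sides vanish, since `1 / 0 = 0`; this lets the resonant index `k = N` follow
the general formula below. -/
lemma integral_sub_pi_mul_sin (m : ℤ) :
    ∫ u in (0 : ℝ)..2 * Real.pi, (u - Real.pi) * Real.sin (m * u) = -(2 * Real.pi) * (1 / m) := by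
  rcases eq_or_ne m 0 with rfl | hm
  · simp
  have hm' : (m : ℝ) ≠ 0 := by exact_mod_cast hm
  have hd : ∀ u : ℝ, HasDerivAt
      (fun u : ℝ => (Real.pi - u) * (Real.cos (m * u) / m) + Real.sin (m * u) / m / m)
      ((u - Real.pi) * Real.sin (m * u)) u := fun u => by
    have h0 : HasDerivAt (fun x : ℝ => (m : ℝ) * x) m u := by
      simpa using (hasDerivAt_id u).const_mul (m : ℝ)
    have h1 : HasDerivAt (fun x : ℝ => Real.pi - x) (-1) u := (hasDerivAt_id u).const_sub _
    refine ((h1.mul (h0.cos.div_const (m : ℝ))).add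
      ((h0.sin.div_const (m : ℝ)).div_const (m : ℝ))).congr_deriv ?_
    field_simp
    ring
  rw [intervalIntegral.integral_eq_sub_of_hasDerivAt (fun u _ => hd u)
    (Continuous.intervalIntegrable (by fun_prop) _ _)]
  have hc : Real.cos (m * (2 * Real.pi)) = 1 := Real.cos_int_mul_two_pi m
  have hs : Real.sin (m * (2 * Real.pi)) = 0 := by
    have := Real.sin_int_mul_pi (m * 2)
    push_cast at this
    rwa [mul_assoc] at this
  rw [hc, hs]
  simp only [mul_zero, Real.cos_zero, Real.sin_zero]
  field_simp
  ring

lemma jumpCoeff_oscSaw (N k : ℕ) :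
    jumpCoeff (oscSaw N) 0 k = -(1 / ((k : ℝ) + N) + 1 / ((k : ℝ) - N)) := by
  set G : ℝ → ℝ := fun u => oscSaw N u * Real.sin (k * u) with hG
  have hper : Function.Periodic G (2 * Real.pi) := fun t => by
    simp only [hG, oscSaw_periodic N t, mul_add, Real.sin_add_nat_mul_two_pi]
  have h1 : ∫ u in (-Real.pi)..Real.pi, G u = ∫ u in (0 : ℝ)..2 * Real.pi, G u := by
    have := hper.intervalIntegral_add_eq (-Real.pi) 0
    rwa [show -Real.pi + 2 * Real.pi = Real.pi by ring, zero_add] at this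
  have h2 : ∫ u in (0 : ℝ)..2 * Real.pi, G u = ∫ u in (0 : ℝ)..2 * Real.pi,
      (1 / 2 * ((u - Real.pi) * Real.sin (((k + N : ℤ) : ℝ) * u)) +
        1 / 2 * ((u - Real.pi) * Real.sin (((k - N : ℤ) : ℝ) * u))) := by
    refine intervalIntegral.integral_congr_ae ?_
    have hne : ∀ᵐ u : ℝ, u ≠ 2 * Real.pi :=
      (Set.countable_singleton (2 * Real.pi)).ae_notMem MeasureTheory.volume
    filter_upwards [hne] with u hu hu'
    rw [Set.uIoc_of_le (by positivity)] at hu'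
    simp only [hG]
    rw [oscSaw_eq N ⟨hu'.1.le, lt_of_le_of_ne hu'.2 hu⟩]
    push_cast
    rw [show ((k : ℝ) + N) * u = k * u + N * u by ring,
      show ((k : ℝ) - N) * u = k * u - N * u by ring, Real.sin_add, Real.sin_sub]
    ring
  rw [jumpCoeff]
  simp only [zero_add]
  rw [h1, h2, intervalIntegral.integral_add (Continuous.intervalIntegrable (by fun_prop) _ _)
    (Continuous.intervalIntegrable (by fun_prop) _ _), intervalIntegral.integral_const_mul,
    intervalIntegral.integral_const_mul, integral_sub_pi_mul_sin, integral_sub_pi_mul_sin]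
  push_cast
  have := Real.pi_ne_zero
  generalize 1 / ((k : ℝ) + N) = p
  generalize 1 / ((k : ℝ) - N) = q
  field_simp
  ring

/-- Resonance: for `k < N` the coefficient contains `1/(N - k)`, and `k/(N - k) = N/(N - k) - 1`
sums to about `N H_N`. The `5/2` collects this `1`, the bound `1/2` for `k/(k + N)`, and `1` for
replacing `H_{N-1}` by `H_N`. -/
lemma le_jumpSum_oscSaw (n : ℕ) :
    ((n + 1 : ℕ) : ℝ) * (∑ i ∈ Finset.range (n + 1), 1 / ((i : ℝ) + 1) - 5 / 2) ≤
      jumpSum (oscSaw (n + 1)) 0 (n + 1) := by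
  set N : ℝ := ((n + 1 : ℕ) : ℝ) with hN
  have hN0 : 0 < N := by positivity
  -- The unsimplified `n + 1 - 1 - k` matches `Finset.sum_range_reflect`; at `k = n` it is `0` and
  -- `1 / 0 = 0` keeps the bound true.
  have hterm : ∀ k ∈ Finset.range (n + 1), N * (1 / ((n + 1 - 1 - k : ℕ) : ℝ)) - 3 / 2 ≤
      ((k + 1 : ℕ) : ℝ) * jumpCoeff (oscSaw (n + 1)) 0 (k + 1) := by
    intro k hk
    have hk := Finset.mem_range.1 hk
    rw [jumpCoeff_oscSaw, ← hN]
    set m : ℝ := ((k + 1 : ℕ) : ℝ) with hm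
    have hm0 : 0 < m := by positivity
    have hmN : m ≤ N := by rw [hm, hN]; exact_mod_cast hk
    have e : ((n + 1 - 1 - k : ℕ) : ℝ) = N - m := by
      rw [Nat.cast_sub (by omega), hN, hm]; push_cast; simp
    have h1 : m * (1 / (m + N)) ≤ 1 / 2 := by
      rw [mul_one_div, div_le_div_iff₀ (by positivity) (by norm_num)]; linarith
    have h2 : N * (1 / (N - m)) - 1 ≤ -(m * (1 / (m - N))) := by
      rcases hmN.eq_or_lt with h | h
      · rw [h]; simp
      · have h' : N - m ≠ 0 := (sub_pos.2 h).ne'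
        have h'' : m - N ≠ 0 := (sub_neg.2 h).ne
        refine le_of_eq ?_
        rw [← neg_sub N m, one_div_neg_eq_neg_one_div]
        field_simp
        ring
    rw [e]
    linarith
  have h := Finset.sum_le_sum hterm
  rw [Finset.sum_sub_distrib, ← Finset.mul_sum,
    Finset.sum_range_reflect (fun j : ℕ => 1 / (j : ℝ)) (n + 1), Finset.sum_range_succ'] at h
  simp only [Finset.sum_const, Finset.card_range, nsmul_eq_mul, Nat.cast_zero, div_zero, add_zero,
    ← hN] at h
  rw [Finset.sum_range_succ]
  have e : (1 : ℝ) / ((n : ℝ) + 1) ≤ 1 := by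
    rw [div_le_one (by positivity)]; linarith [(Nat.cast_nonneg n : (0 : ℝ) ≤ n)]
  refine le_trans ?_ h
  push_cast
  nlinarith

/-! ### Condensation of singularities -/

/-- Uniform boundedness on `ℓ¹`: an unbounded matrix with bounded rows maps some absolutely summable
sequence to an unbounded one. -/
lemma exists_summable_unbounded {A : ℕ → ℕ → ℝ} {B : ℕ → ℝ} (hB : ∀ n j, |A n j| ≤ B n)
    (hA : ∀ C, ∃ n j, C < |A n j|) :
    ∃ c : ℕ → ℝ, Summable (fun j => |c j|) ∧ ∀ C, ∃ n, C < |∑' j, c j * A n j| := by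
  have hsum : ∀ (c : lp (fun _ : ℕ => ℝ) 1), Summable fun j => |c j| := fun c => by
    simpa using (lp.memℓp c).summable (by simp)
  have hnorm : ∀ (c : lp (fun _ : ℕ => ℝ) 1), ‖c‖ = ∑' j, |c j| := fun c => by
    simpa using lp.norm_eq_tsum_rpow (by simp) c
  have hle : ∀ n (c : ℕ → ℝ) j, |c j * A n j| ≤ B n * |c j| := fun n c j => by
    rw [abs_mul, mul_comm]
    exact mul_le_mul_of_nonneg_right (hB n j) (abs_nonneg _)
  have hs : ∀ n (c : lp (fun _ : ℕ => ℝ) 1), Summable fun j => c j * A n j := fun n c =>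
    Summable.of_norm_bounded ((hsum c).mul_left (B n)) (hle n c)
  let T : ℕ → lp (fun _ : ℕ => ℝ) 1 →L[ℝ] ℝ := fun n => LinearMap.mkContinuous
    { toFun := fun c => ∑' j, c j * A n j
      map_add' := fun c d => by
        rw [← (hs n c).tsum_add (hs n d)]
        simp [add_mul]
      map_smul' := fun r c => by
        simp [mul_assoc, tsum_mul_left] } (B n) fun c => by
      rw [hnorm, ← tsum_mul_left]
      exact tsum_of_norm_bounded ((hsum c).mul_left (B n)).hasSum (hle n c)
  by_contra! hcon
  obtain ⟨C, hC⟩ := banach_steinhaus (g := T) fun c => hcon c (hsum c)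
  obtain ⟨n, j, hnj⟩ := hA C
  -- Testing on unit vectors turns a uniform bound on the functionals into one on all entries of the
  -- matrix.
  have h1 := (T n).le_of_opNorm_le (hC n) (lp.single 1 j (1 : ℝ))
  have h2 : T n (lp.single 1 j (1 : ℝ)) = A n j := by
    change ∑' i, (lp.single (E := fun _ : ℕ => ℝ) 1 j (1 : ℝ)) i * A n i = A n j
    rw [tsum_eq_single j fun i hi => by rw [lp.single_apply_ne _ _ _ hi, zero_mul],
      lp.single_apply_self, one_mul]
  rw [h2, lp.norm_single (by simp), norm_one, mul_one, Real.norm_eq_abs] at h1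
  linarith

/-- Absolutely convergent combinations of functions whose `Λ`-variations are at most `1`. -/
lemma tsum_mem_lambdaBV {lam : ℕ → ℝ} (hl : IsWatermanSeq lam) {θ : ℕ → ℝ → ℝ} {D : ℝ}
    (hper : ∀ j, Function.Periodic (θ j) (2 * Real.pi)) (hD : ∀ j u, |θ j u| ≤ D)
    (hvar : ∀ j (N : ℕ) (a b : Fin N → ℝ), IsNonoverlapping a b →
      ∑ i : Fin N, |θ j (b i) - θ j (a i)| / lam i ≤ 1)
    {c : ℕ → ℝ} (hc : Summable fun j => |c j|) :
    (fun u => ∑' j, c j * θ j u) ∈ LambdaBV lam := by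
  have hs : ∀ u, Summable fun j => c j * θ j u := fun u =>
    Summable.of_norm_bounded (hc.mul_right D) fun j => by
      rw [Real.norm_eq_abs, abs_mul]
      exact mul_le_mul_of_nonneg_left (hD j u) (abs_nonneg _)
  refine mem_lambdaBV_of_bound (fun u => by simp only [fun j => hper j u]) (V := ∑' j, |c j|)
    fun N a b hab => ?_
  have hlim : Tendsto (fun m : ℕ => ∑ i : Fin N, |∑ j ∈ Finset.range m, c j * θ j (b i) -
      ∑ j ∈ Finset.range m, c j * θ j (a i)| / lam i) atTop
      (𝓝 (∑ i : Fin N, |∑' j, c j * θ j (b i) - ∑' j, c j * θ j (a i)| / lam i)) :=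
    tendsto_finsetSum _ fun i _ =>
      (((hs (b i)).hasSum.tendsto_sum_nat.sub (hs (a i)).hasSum.tendsto_sum_nat).abs).div_const _
  refine le_of_tendsto hlim (Eventually.of_forall fun m => ?_)
  calc _ ≤ ∑ i : Fin N, ∑ j ∈ Finset.range m, |c j| * (|θ j (b i) - θ j (a i)| / lam i) := by
        refine Finset.sum_le_sum fun i _ => ?_
        rw [← Finset.sum_sub_distrib]
        simp only [← mul_sub, ← mul_div_assoc]
        rw [← Finset.sum_div]
        refine div_le_div_of_nonneg_right ?_ (hl.pos _).le
        refine (Finset.abs_sum_le_sum_abs _ _).trans (le_of_eq ?_)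
        simp only [abs_mul]
    _ = ∑ j ∈ Finset.range m, |c j| * ∑ i : Fin N, |θ j (b i) - θ j (a i)| / lam i := by
        rw [Finset.sum_comm]
        simp only [Finset.mul_sum]
    _ ≤ ∑ j ∈ Finset.range m, |c j| := Finset.sum_le_sum fun j _ =>
        mul_le_of_le_one_right (abs_nonneg _) (hvar j N a b hab)
    _ ≤ ∑' j, |c j| := hc.sum_le_tsum _ fun _ _ => abs_nonneg _

/-- For fixed `n` the kernel is bounded by `n`, so `|c j| * (D * n)` is a summable majorant and sum
and integral may be interchanged. -/
lemma jumpSum_tsum {θ : ℕ → ℝ → ℝ} {D : ℝ} (hθ : ∀ j, IsBoundedPeriodic (θ j))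
    (hD : ∀ j u, |θ j u| ≤ D) {c : ℕ → ℝ} (hc : Summable fun j => |c j|)
    (hg : IsBoundedPeriodic fun u => ∑' j, c j * θ j u) (x : ℝ) (n : ℕ) :
    jumpSum (fun u => ∑' j, c j * θ j u) x n / n = ∑' j, c j * (jumpSum (θ j) x n / n) := by
  have hle : ∀ j u, |c j * θ j (x + u) * jumpKernel n u| ≤ |c j| * (D * n) := fun j u => by
    rw [mul_assoc, abs_mul, abs_mul]
    exact mul_le_mul_of_nonneg_left (mul_le_mul (hD j _) (abs_jumpKernel_le n u) (abs_nonneg _)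
      ((abs_nonneg _).trans (hD j (x + u)))) (abs_nonneg _)
  have hs : ∀ u, Summable fun j => c j * θ j (x + u) * jumpKernel n u := fun u =>
    Summable.of_norm_bounded (hc.mul_right (D * n)) fun j => hle j u
  have key := intervalIntegral.hasSum_integral_of_dominated_convergence
    (μ := MeasureTheory.volume) (a := -Real.pi) (b := Real.pi)
    (F := fun j u => c j * θ j (x + u) * jumpKernel n u)
    (f := fun u => ∑' j, c j * θ j (x + u) * jumpKernel n u)
    (fun j _ => |c j| * (D * n))
    (fun j => (((hθ j).comp_add x).aemeasurable.const_mul (c j) |>.mul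
      (continuous_jumpKernel n).measurable.aemeasurable).aestronglyMeasurable.restrict)
    (fun j => Eventually.of_forall fun u _ => hle j u)
    (Eventually.of_forall fun u _ => hc.mul_right _)
    intervalIntegrable_const (Eventually.of_forall fun u _ => (hs u).hasSum)
  rw [jumpSum_div_eq hg]
  simp only [jumpSum_div_eq (hθ _)]
  simp only [tsum_mul_right] at key
  simp only [mul_assoc, intervalIntegral.integral_const_mul] at key
  rw [← key.tsum_eq, ← tsum_mul_left]
  exact tsum_congr fun j => by ring

lemma exists_mem_lambdaBV_jumpSum_unbounded {lam : ℕ → ℝ} (hl : IsWatermanSeq lam)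
    (hnot : ¬ LambdaBV lam ⊆ HBV) :
    ∃ g ∈ LambdaBV lam, ∀ C : ℝ, ∃ n : ℕ, C < |jumpSum g 0 n / n| := by
  have hpi := Real.pi_pos
  set L : ℕ → ℝ := fun j => (6 * Real.pi + 2 * Real.pi ^ 2) * ∑ i ∈ Finset.range (j + 1), 1 / lam i
    with hL
  set θ : ℕ → ℝ → ℝ := fun j u => (L j)⁻¹ * oscSaw (j + 1) u with hθ
  have hl0 := hl.pos 0
  have hLlam : ∀ j, 1 / lam 0 ≤ ∑ i ∈ Finset.range (j + 1), 1 / lam i := fun j =>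
    Finset.single_le_sum (f := fun i => 1 / lam i) (fun i _ => (one_div_pos.2 (hl.pos i)).le)
      (Finset.mem_range.2 j.succ_pos)
  set L₀ : ℝ := (6 * Real.pi + 2 * Real.pi ^ 2) * (1 / lam 0) with hL₀
  have hL₀0 : 0 < L₀ := by positivity
  have hLL : ∀ j, L₀ ≤ L j := fun j => mul_le_mul_of_nonneg_left (hLlam j) (by positivity)
  have hL0 : ∀ j, 0 < L j := fun j => hL₀0.trans_le (hLL j)
  have hD : ∀ j u, |θ j u| ≤ L₀⁻¹ * Real.pi := fun j u => by
    rw [hθ, abs_mul, abs_of_pos (inv_pos.2 (hL0 j))]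
    exact mul_le_mul (inv_anti₀ hL₀0 (hLL j)) (abs_oscSaw_le _ _) (abs_nonneg _)
      (inv_pos.2 hL₀0).le
  have hb : ∀ j, IsBoundedPeriodic (θ j) := fun j =>
    ⟨fun u => by simp only [hθ, oscSaw_periodic (j + 1) u],
      (measurable_oscSaw _).aemeasurable.const_mul _, _, hD j⟩
  have hvar : ∀ j (N : ℕ) (a b : Fin N → ℝ), IsNonoverlapping a b →
      ∑ i : Fin N, |θ j (b i) - θ j (a i)| / lam i ≤ 1 := fun j N a b hab => by
    have := sum_abs_oscSaw_sub_div_le hl j.succ_ne_zero hab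
    simp only [hθ, ← mul_sub, abs_mul, abs_of_pos (inv_pos.2 (hL0 j)), mul_div_assoc]
    rw [← Finset.mul_sum, inv_mul_le_iff₀ (hL0 j), mul_one]
    exact this
  have hA : ∀ n j, |jumpSum (θ j) 0 n / n| ≤
      1 / Real.pi * (L₀⁻¹ * Real.pi * n * (Real.pi - -Real.pi)) := fun n j => by
    rw [jumpSum_div_eq (hb j), abs_mul, abs_of_pos (by positivity)]
    exact mul_le_mul_of_nonneg_left (abs_integral_mul_jumpKernel_le (by linarith)
      (fun u _ => hD j _) n) (by positivity)
  have hscale : ∀ j n, jumpSum (θ j) 0 n = (L j)⁻¹ * jumpSum (oscSaw (j + 1)) 0 n := fun j n => by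
    simp only [jumpSum, jumpCoeff, hθ, mul_assoc, intervalIntegral.integral_const_mul,
      Finset.mul_sum]
    exact Finset.sum_congr rfl fun k _ => by ring
  -- Otherwise the diagonal entries, with `n = j + 1`, would bound the harmonic sums by the Λ-sums.
  -- The additive `5/2` is absorbed into `K` because `lam 0` times the Λ-sum is at least `1`.
  have hunb : ∀ C, ∃ n j, C < |jumpSum (θ j) 0 n / n| := by
    by_contra! hcon
    obtain ⟨C, hC⟩ := hcon
    have hC0 : 0 ≤ C := (abs_nonneg _).trans (hC 0 0)
    refine hnot (lambdaBV_subset_HBV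
      (K := C * (6 * Real.pi + 2 * Real.pi ^ 2) + 5 / 2 * lam 0) (fun n => ?_) (by positivity))
    cases n with
    | zero => simp
    | succ j =>
      have h1 := (le_abs_self _).trans (hC (j + 1) j)
      rw [hscale, mul_div_assoc, inv_mul_le_iff₀ (hL0 j), div_le_iff₀ (by positivity)] at h1
      have h2 := (le_jumpSum_oscSaw j).trans h1
      rw [mul_comm] at h2
      have h3 := le_of_mul_le_mul_right h2 (by positivity)
      have h4 := mul_le_mul_of_nonneg_left (hLlam j) hl0.le
      rw [mul_one_div, div_self hl0.ne'] at h4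
      simp only [hL] at h3
      linarith
  obtain ⟨c, hc, hc'⟩ := exists_summable_unbounded hA hunb
  have hmem := tsum_mem_lambdaBV hl (fun j => (hb j).periodic) hD hvar hc
  refine ⟨_, hmem, fun C => ?_⟩
  obtain ⟨n, hn⟩ := hc' C
  exact ⟨n, by rwa [jumpSum_tsum hb hD hc (LambdaBV.isBoundedPeriodic hl hmem)]⟩

/-! ### Conclusion -/

theorem mainTheorem1 :
    (∀ g ∈ HBV, ∀ x₀ : ℝ, ∃ gp gm : ℝ,
      Tendsto g (𝓝[>] x₀) (𝓝 gp) ∧ Tendsto g (𝓝[<] x₀) (𝓝 gm) ∧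
      ∀ r : ℕ, TailConverges (2 * r + 1) g x₀ ∧ JumpFormula r g x₀ gp gm) ∧
    (∀ lam : ℕ → ℝ, IsWatermanSeq lam → HBV ⊂ LambdaBV lam →
      ∃ g ∈ LambdaBV lam \ HBV, ∃ x₀ gp gm : ℝ,
        Tendsto g (𝓝[>] x₀) (𝓝 gp) ∧ Tendsto g (𝓝[<] x₀) (𝓝 gm) ∧
        ∀ r : ℕ, TailConverges (2 * r + 1) g x₀ ∧ ¬ JumpFormula r g x₀ gp gm) := by
  have hpart : ∀ g ∈ HBV, ∀ x₀ gp gm : ℝ, Tendsto g (𝓝[>] x₀) (𝓝 gp) →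
      Tendsto g (𝓝[<] x₀) (𝓝 gm) →
      ∀ r : ℕ, TailConverges (2 * r + 1) g x₀ ∧ JumpFormula r g x₀ gp gm := by
    intro g hg x₀ gp gm hp hm r
    have hb := LambdaBV.isBoundedPeriodic isWatermanSeq_nat_add_one hg
    exact ⟨tailConverges hb r x₀, jumpFormula_of_tendsto hb (HBV.tendsto_jumpSum hg hp hm) r⟩
  refine ⟨fun g hg x₀ => ?_, fun lam hl hss => ?_⟩
  · obtain ⟨gp, hp⟩ := LambdaBV.exists_tendsto_right isWatermanSeq_nat_add_one hg x₀
    obtain ⟨gm, hm⟩ := LambdaBV.exists_tendsto_left isWatermanSeq_nat_add_one hg x₀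
    exact ⟨gp, gm, hp, hm, hpart g hg x₀ gp gm hp hm⟩
  · obtain ⟨g, hg, hunb⟩ := exists_mem_lambdaBV_jumpSum_unbounded hl hss.2
    obtain ⟨gp, hp⟩ := LambdaBV.exists_tendsto_right hl hg 0
    obtain ⟨gm, hm⟩ := LambdaBV.exists_tendsto_left hl hg 0
    have hb := LambdaBV.isBoundedPeriodic hl hg
    have hfail : ∀ r, ¬ JumpFormula r g 0 gp gm := fun r hr => by
      obtain ⟨C, hC⟩ := hr.exists_abs_jumpSum_le hb
      obtain ⟨n, hn⟩ := hunb |C|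
      rcases Nat.eq_zero_or_pos n with rfl | hn0
      · simp only [Nat.cast_zero, div_zero, abs_zero] at hn
        exact absurd (abs_nonneg C) hn.not_ge
      · have hn' : (0 : ℝ) < n := by exact_mod_cast hn0
        rw [abs_div, Nat.abs_cast, lt_div_iff₀ hn'] at hn
        have := mul_le_mul_of_nonneg_right (le_abs_self C) hn'.le
        linarith [hC n]
    -- Part (a) would give the jump formula if `g` were in `HBV`, so its failure also places `g`
    -- outside `HBV`.
    exact ⟨g, ⟨hg, fun hH => hfail 0 (hpart g hH 0 gp gm hp hm 0).2⟩, 0, gp, gm, hp, hm,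
      fun r => ⟨tailConverges hb r 0, hfail r⟩⟩
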